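/- **Setting.** Fix an $[[n,k]]$ stabilizer code. A faulty error-corrected logical gate $G$ is a sequence of noiseless quantum operations on a register containing the $n$ data qubits and ancillas, ending with the read-out of a local syndrome $s$ and the removal of the ancillas, with finitely many fault locations; at each of them, independently and with probability $\epsilon$, a random non-identity Pauli fault occurs (with a distribution that depends on the location but not on $\epsilon$). Its fault-free version $G_{ideal}$ maps every state into the code space and acts on code states as a unitary logical gate $g$. Every possible fault-path (choice of faults), applied to an error-free code state, produces a random Pauli error after $g$. $G$ is $t$-fault-tolerant if every Pauli input error of weight $w_{in}$ combined with $w_f$ faults, $w_{in}+w_f\le t$, results, for each syndrome, in a random Pauli error of weight at most $w_f$ after $g$. Let $C=G_V\cdots G_1$ be a circuit of $t$-fault-tolerant gates, let $|c\rangle\rangle$ denote arbitrary code states, and define for $1\le j<V$ the exact channels by $\Lambda_{in}^{(1)}=I$ and $$G_j\Lambda_{in}^{(j)}|c\rangle\rangle=\Lambda_{out}^{(j)}g_j|c\rangle\rangle,\qquad G_{j+1,ideal}\Lambda_{out}^{(j)}|c\rangle\rangle=g_{j+1}\Lambda_L^{(j)}|c\rangle\rangle,\qquad \Lambda_{in}^{(j+1)}=\Lambda_{out}^{(j)}(\Lambda_L^{(j)})^{-1}.$$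 The P2LC algorithm computes $\tilde\Lambda_L^{(j)}$ as follows. If $j=1$, put $\Lambda_{in}^{R,(1)}=I$. If $j>1$, obtain $\Lambda_{out}^{R,(j-1)}$ from the first equation for $G_{j-1}$ with $\Lambda_{in}^{(j-1)}$ replaced by $I$, write it as a Pauli channel, and let $\Lambda_{in}^{R,(j)}$ be this channel with each Pauli error $P$ that is not correctable by the next gate (i.e. does not satisfy $G_{j,ideal}P|c\rangle\rangle=g_j|c\rangle\rangle$ for all code states) replaced by $I$. Then obtain $\tilde\Lambda_L^{(j)}$ from $\Lambda_{in}^{R,(j)}$ by the first two equations for $j$. **Proposition.** Let $1\le j<V$. (i) $\tilde\Lambda_L^{(j)}$ is well defined, and depends only on the faulty gates $G_{j-1},G_j$ (only $G_1$ if $j=1$) and the ideal gate $G_{j+1,ideal}$. (ii) As $\epsilon\to0^+$ for a fixed circuit, the exact channels $\Lambda_L^{(1)},\dots,\Lambda_L^{(j)}$ are invertible for all sufficiently small $\epsilon$, the infidelity $\epsilon_L^{(j)}$ of $\Lambda_L^{(j)}$ is $O(\epsilon^{t+1})$, and $$\tilde\Lambda_L^{(j)}=\Lambda_L^{(j)}+O(\epsilon^{t+2}).$$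 Hence $\tilde\Lambda_L^{(j)}=\Lambda_L^{(j)}+O(\epsilon_L^{(j)}\epsilon)$ whenever $\epsilon_L^{(j)}$ is of order exactly $\epsilon^{t+1}$, i.e. $\epsilon_L^{(j)}\ge c\,\epsilon^{t+1}$ for some $c>0$ and all small $\epsilon>0$. (iii) The same holds for the channels conditioned on the local syndromes: let $A_i$ be sets of syndromes of the gates $G_i$ (single syndromes, or cells of a partition) that occur with non-zero probability when $G_{i,ideal}$ acts on code states; replace every $G_i$ and $G_{i,ideal}$ above by its restriction to the runs with syndrome in $A_i$, and normalize $\Lambda_{out}$ and $\Lambda_L$ (and their P2LC analogues) to unit trace on the maximally mixed code state. Then $\tilde\Lambda^{(j)}_{L|A_{j-1},A_j,A_{j+1}}$ depends only on the conditioned gates $G_{j-1},G_j$ and the conditioned ideal gate $G_{j+1,ideal}$, and (ii) holds for it and $\Lambda^{(j)}_{L|A_1,\dots,A_{j+1}}$. -/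

import Mathlib

open scoped Matrix Topology
open Filter

namespace FTQC

noncomputable section

/-! ### Qubits, Pauli operators and quantum operations -/

/-- Labels of the computational basis of `n` qubits. -/
abbrev Bits (n : ℕ) := Fin n → Fin 2

/-- Operators on a Hilbert space with an orthonormal basis labelled by `ι`. -/
abbrev Op (ι : Type*) := Matrix ι ι ℂ

/-- Superoperators from operators on `n` qubits to operators on `m` qubits. -/
abbrev Super (n m : ℕ) := Op (Bits n) →ₗ[ℂ] Op (Bits m)

/-- The map `ρ ↦ K ρ Kᴴ`. -/
def conjBy {ι κ : Type*} [Fintype κ] (K : Matrix ι κ ℂ) : Op κ →ₗ[ℂ] Op ι where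
  toFun ρ := K * ρ * Kᴴ
  map_add' x y := by rw [Matrix.mul_add, Matrix.add_mul]
  map_smul' c x := by simp

/-- An `n`-qubit Pauli operator up to phase; the letters `0, 1, 2, 3` stand for `I, X, Y, Z`. -/
abbrev Pauli (n : ℕ) := Fin n → Fin 4

/-- The four one-qubit Pauli matrices. -/
def pauliOne : Fin 4 → Matrix (Fin 2) (Fin 2) ℂ :=
  ![1, !![0, 1; 1, 0], !![0, -Complex.I; Complex.I, 0], !![1, 0; 0, -1]]

/-- The tensor product of one-qubit Pauli matrices. -/
def pauliMatrix {n : ℕ} (P : Pauli n) : Op (Bits n) :=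
  Matrix.of fun x y => ∏ i, pauliOne (P i) (x i) (y i)

/-- The number of qubits on which a Pauli operator acts non-trivially. -/
def weight {n : ℕ} (P : Pauli n) : ℕ := (Finset.univ.filter fun i => P i ≠ 0).card

/-- The Pauli error `ρ ↦ P ρ Pᴴ`. -/
def pauliConj {n : ℕ} (P : Pauli n) : Super n n := conjBy (pauliMatrix P)

/-- A quantum instrument: a finite family of completely positive maps (in Kraus form), one for each
classical outcome, whose sum is trace preserving. -/
def IsInstrument {n m : ℕ} {S : Type*} [Fintype S] (T : S → Super n m) : Prop :=
  ∃ (r : ℕ) (K : S → Fin r → Matrix (Bits m) (Bits n) ℂ),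
    (∀ s, T s = ∑ a, conjBy (K s a)) ∧ ∑ s, ∑ a, (K s a)ᴴ * K s a = 1

/-- A quantum channel: completely positive and trace preserving. -/
def IsChannel {n m : ℕ} (T : Super n m) : Prop := IsInstrument fun _ : Unit => T

/-! ### The code -/

/-- `W` is the encoding isometry of a stabilizer code with `k` logical and `n` physical qubits: the
code space (the range of `W`) is the joint `+1` eigenspace of a set of signed Pauli operators. -/
def IsStabilizerCode {n k : ℕ} (W : Matrix (Bits n) (Bits k) ℂ) : Prop :=
  Wᴴ * W = 1 ∧ ∃ T : Set (ℤˣ × Pauli n), ∀ v : Bits n → ℂ,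
    (∃ w, v = W *ᵥ w) ↔ ∀ τ ∈ T, (((τ.1 : ℤ) : ℂ)) • (pauliMatrix τ.2 *ᵥ v) = v

/-- Encoding of a logical operator. The code states are the `enc W ρ`. -/
def enc {n k : ℕ} (W : Matrix (Bits n) (Bits k) ℂ) : Super k n := conjBy W

/-- Left inverse of `enc W`; on operators supported on the code space it is the inverse. -/
def dec {n k : ℕ} (W : Matrix (Bits n) (Bits k) ℂ) : Super n k := conjBy Wᴴ

/-! ### Faulty error-corrected logical gates -/

/-- A faulty error-corrected logical gate `G` with circuit-level Pauli noise, on `n` data qubits.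
It runs on a register of `reg` qubits (data and ancillas, including recorded measurement outcomes,
on which later operations may depend). The noiseless operations are `init`, then `step 0`,
`step 1`, …, and finally `final`, which discards the ancillas and reads out the local syndrome
`s : S`. There are `locs` fault locations, the `l`-th of them directly before `step l`; there, with
probability `ε` a fault occurs, which is the non-identity Pauli operator `P` with probability
`fault l P`. The unitary `logical` is the intended logical gate. -/
structure Gate (n k : ℕ) (S : Type*) [Fintype S] where
  reg : ℕ
  locs : ℕ
  init : Super n reg
  step : Fin locs → Super reg reg
  final : S → Super reg n
  fault : Fin locs → Pauli reg → ℝ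
  logical : Matrix.unitaryGroup (Bits k) ℂ
  init_channel : IsChannel init
  step_channel : ∀ l, IsChannel (step l)
  final_instrument : IsInstrument final
  fault_nonneg : ∀ l P, 0 ≤ fault l P
  fault_zero : ∀ l, fault l 0 = 0
  fault_sum : ∀ l, ∑ P, fault l P = 1

namespace Gate

variable {n k : ℕ} {S : Type*} [Fintype S]

/-- The gate with the operation `Φ l` inserted at each fault location `l`, restricted to the runs
whose syndrome is `s` (hence trace non-increasing). -/
def run (G : Gate n k S) (Φ : Fin G.locs → Super G.reg G.reg) (s : S) : Super n n :=
  G.final s ∘ₗ Fin.foldl G.locs (fun T l => G.step l ∘ₗ Φ l ∘ₗ T) G.init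

/-- The Pauli fault channel with infidelity `ε` at the location `l`. -/
def faultChannel (G : Gate n k S) (ε : ℝ) (l : Fin G.locs) : Super G.reg G.reg :=
  ((1 - ε : ℝ) : ℂ) • LinearMap.id + (ε : ℂ) • ∑ P, (G.fault l P : ℂ) • pauliConj P

/-- The faulty gate, restricted to the runs whose syndrome lies in `A`. For `A` the set of all
syndromes this is the whole faulty gate, a quantum channel. -/
def noisy (G : Gate n k S) (ε : ℝ) (A : Finset S) : Super n n :=
  ∑ s ∈ A, G.run (G.faultChannel ε) s

/-- The ideal (fault-free) gate, restricted to the runs whose syndrome lies in `A`. -/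
def ideal (G : Gate n k S) (A : Finset S) : Super n n :=
  ∑ s ∈ A, G.run (fun _ => LinearMap.id) s

/-- The ideal logical gate `g`. -/
def g (G : Gate n k S) : Super k k := conjBy (G.logical : Op (Bits k))

/-- The inverse of the ideal logical gate. -/
def gInv (G : Gate n k S) : Super k k := conjBy (G.logical : Op (Bits k))ᴴ

/-- The fault-free gate acts as `g` on code states and maps every state into the code space. -/
def Implements (G : Gate n k S) (W : Matrix (Bits n) (Bits k) ℂ) : Prop :=
  (∀ ρ, G.ideal Finset.univ (enc W ρ) = enc W (G.g ρ)) ∧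
    ∀ X, ∃ ρ, G.ideal Finset.univ X = enc W ρ

/-- `F` is a fault-path that the noise model allows; `F l = 0` means no fault at `l`. -/
def IsFaultPath (G : Gate n k S) (F : Fin G.locs → Pauli G.reg) : Prop :=
  ∀ l, F l ≠ 0 → 0 < G.fault l (F l)

/-- The number of faults in a fault-path. -/
def numFaults (G : Gate n k S) (F : Fin G.locs → Pauli G.reg) : ℕ :=
  (Finset.univ.filter fun l => F l ≠ 0).card

/-- The gate with the faults of the fault-path `F`, restricted to the runs with syndrome `s`. -/
def runPath (G : Gate n k S) (F : Fin G.locs → Pauli G.reg) (s : S) : Super n n :=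
  G.run (fun l => pauliConj (F l)) s

/-- The noise is Pauli noise also at the level of the gate: on an error-free code state, every
fault-path results in a (random) Pauli error after the logical gate. -/
def HasPauliErrors (G : Gate n k S) (W : Matrix (Bits n) (Bits k) ℂ) : Prop :=
  ∀ F, G.IsFaultPath F → ∀ s, ∃ p : Pauli n → ℝ, (∀ Q, 0 ≤ p Q) ∧
    ∀ ρ, G.runPath F s (enc W ρ) = ∑ Q, (p Q : ℂ) • pauliConj Q (enc W (G.g ρ))

/-- `t`-fault-tolerance: an input error of weight `w_in` and `w_f` internal faults, with
`w_in + w_f ≤ t`, result in an output error of weight at most `w_f` (for each syndrome `s`, the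
output is `∑ Q, p Q • Q g ρ Q`, where `p Q` is the joint probability of `s` and `Q`). -/
def IsFaultTolerant (G : Gate n k S) (W : Matrix (Bits n) (Bits k) ℂ) (t : ℕ) : Prop :=
  ∀ (E : Pauli n) (F : Fin G.locs → Pauli G.reg), G.IsFaultPath F →
    weight E + G.numFaults F ≤ t → ∀ s, ∃ p : Pauli n → ℝ, (∀ Q, 0 ≤ p Q) ∧
      (∀ Q, G.numFaults F < weight Q → p Q = 0) ∧
      ∀ ρ, G.runPath F s (pauliConj E (enc W ρ)) = ∑ Q, (p Q : ℂ) • pauliConj Q (enc W (G.g ρ))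

/-- A Pauli error is correctable by the gate if it is corrected when no faults occur in the gate. -/
def Correctable (G : Gate n k S) (W : Matrix (Bits n) (Bits k) ℂ) (P : Pauli n) : Prop :=
  ∀ ρ, G.ideal Finset.univ (pauliConj P (enc W ρ)) = enc W (G.g ρ)

/-- Syndromes in `A` occur with non-zero probability when the gate acts, without faults, on
code states. -/
def Occurs (G : Gate n k S) (W : Matrix (Bits n) (Bits k) ℂ) (A : Finset S) : Prop :=
  G.ideal A ∘ₗ enc W ≠ 0

end Gate

/-! ### Conditioning -/

/-- The trace of the image of the maximally mixed state. -/
def prob {k m : ℕ} (M : Super k m) : ℂ := (M 1).trace / (Fintype.card (Bits k) : ℂ)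

/-- Division of a trace non-increasing map by the probability of the event that it describes. -/
def normalize {k m : ℕ} (M : Super k m) : Super k m := (prob M)⁻¹ • M

/-- The normalization does nothing to trace preserving maps. In particular it plays no role if one
conditions on the set of all syndromes, that is, if one does not condition at all. -/
theorem normalize_eq_self {k m : ℕ} (M : Super k m) (hM : ∀ ρ, (M ρ).trace = ρ.trace) :
    normalize M = M := by
  have h : (Fintype.card (Bits k) : ℂ) ≠ 0 := Nat.cast_ne_zero.mpr Fintype.card_ne_zero
  have : prob M = 1 := by
    rw [prob, hM, Matrix.trace_one, div_self h]
  rw [normalize, this, inv_one, one_smul]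

/-! ### Exact logical error channels

The circuit is `G (V - 1) ⋯ G 1 G 0`. For each `i` a set `A i` of local syndromes of the gate `G i`
is given on which one conditions: all of them for the plain channels, `{s i}` for the
syndrome-conditioned ones, one cell of a partition for the subset-conditioned ones. Physical error
channels only ever act on code states, and are given by their composition with `enc W`. -/

section Channels

variable {n k : ℕ} {S : Type*} [Fintype S] (W : Matrix (Bits n) (Bits k) ℂ)

/-- Input error to output error: the solution `Λout` of `G Λin |c⟩⟩ = Λout g |c⟩⟩`. -/
def outputError (G : Gate n k S) (ε : ℝ) (A : Finset S) (Λin : Super k n) : Super k n :=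
  normalize (G.noisy ε A ∘ₗ Λin ∘ₗ G.gInv)

/-- Output error to logical error: the solution `Λ` of `Gnext_ideal Λout |c⟩⟩ = g_next Λ |c⟩⟩`,
where `Gnext` is the next gate. -/
def logicalError (Gnext : Gate n k S) (A : Finset S) (Λout : Super k n) : Super k k :=
  normalize (Gnext.gInv ∘ₗ dec W ∘ₗ Gnext.ideal A ∘ₗ Λout)

variable (G : ℕ → Gate n k S) (A : ℕ → Finset S) (ε : ℝ)

/-- The input error channels: trivial for the first gate, and
`Λin (j + 1) = Λout j (ΛL j)⁻¹`. -/
def inChannel : ℕ → Super k n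
  | 0 => enc W
  | j + 1 =>
    outputError (G j) ε (A j) (inChannel j) ∘ₗ
      Ring.inverse (M₀ := Module.End ℂ (Op (Bits k)))
        (logicalError W (G (j + 1)) (A (j + 1)) (outputError (G j) ε (A j) (inChannel j)))

/-- The output error channels. -/
def outChannel (j : ℕ) : Super k n := outputError (G j) ε (A j) (inChannel W G A ε j)

/-- The exact logical error channel of the gate `G j`. -/
def logicalChannel (j : ℕ) : Super k k :=
  logicalError W (G (j + 1)) (A (j + 1)) (outChannel W G A ε j)

/-! ### The P2LC algorithm -/

/-- The (sub-normalized) Pauli channel with coefficients `p`, on code states. -/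
def pauliChannel (p : Pauli n → ℝ) : Super k n := ∑ P, (p P : ℂ) • (pauliConj P ∘ₗ enc W)

open Classical in
/-- The correctable part of `pauliChannel W p`: each Pauli error that is not correctable by the
next gate is replaced by the identity. -/
def correctablePart (Gnext : Gate n k S) (p : Pauli n → ℝ) : Super k n :=
  ∑ P, (p P : ℂ) • (if Gnext.Correctable W P then pauliConj P ∘ₗ enc W else enc W)

/-- `Λ` is the input error channel that P2LC uses for the gate `G j`. The first gate has no input
error. For a later gate, the input of the previous gate is taken to be error-free, the resulting
output error channel is written as a Pauli channel, and `Λ` is its correctable part. -/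
def IsP2LCInput : ℕ → Super k n → Prop
  | 0, Λ => Λ = enc W
  | j + 1, Λ => ∃ p : Pauli n → ℝ, (∀ P, 0 ≤ p P) ∧
      outputError (G j) ε (A j) (enc W) = pauliChannel W p ∧
      Λ = correctablePart W (G (j + 1)) p

/-- `Λ` is the approximate logical error channel that P2LC returns for the gate `G j`. -/
def IsP2LC (j : ℕ) (Λ : Super k k) : Prop :=
  ∃ Λin, IsP2LCInput W G A ε j Λin ∧
    Λ = logicalError W (G (j + 1)) (A (j + 1)) (outputError (G j) ε (A j) Λin)

end Channels

/-! ### Infidelity and distance -/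

/-- The (entanglement) infidelity of a logical channel; for a Pauli channel it is one minus the
probability of the identity. -/
def infidelity {k : ℕ} (Λ : Super k k) : ℝ :=
  1 - ((∑ a, ∑ b, Λ (Matrix.single a b 1) a b) / (Fintype.card (Bits k) : ℂ) ^ 2).re

/-- A norm on superoperators: the sum of the moduli of all matrix entries. -/
def superNorm {k : ℕ} (Λ : Super k k) : ℝ :=
  ∑ a, ∑ b, ∑ c, ∑ d, ‖Λ (Matrix.single a b 1) c d‖

end

end FTQC

open FTQC

/-! The argument counts powers of `ε`. An error channel on code states is tracked through an
expansion (`Expands`) in Pauli errors, where an error of weight `w` has a coefficient of order `ε ^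
min w (t + 1)` and the remainder is `O(ε ^ (t + 1))`. Expanding a noisy gate into fault-paths, each
fault costs a factor `ε`, and by fault tolerance an output error of weight `w` needs at least `w`
faults. So the output has such an expansion again. A nontrivial input error costs further powers of
`ε`, so the leading output coefficients depend on the gate alone
(`Gate.IsFaultTolerant.expands_noisy`). Errors of weight at most `t` are correctable, so the logical
channel is the identity up to `O(ε ^ (t + 1))`. It is then invertible for small `ε`, and composing
with its inverse preserves the expansion.

Hence the exact input channel and the P2LC input have coefficients agreeing up to order `min (w + 1)
(t + 1)`. This alone leaves an error `ε ^ (t + 1)` on the fault-free path of the current gate. That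
path is handled exactly: both inputs are decoded by the ideal gate to an exact multiple of the
identity, the exact one because the logical error has been divided out, the P2LC one because only
correctable errors remain. Every other path has at least one fault. Pairs of an input error and a
fault-path with total order at most `t` contribute multiples of the identity. The other pairs
contribute to the difference of the two logical channels only at order `t + 2`. Normalization
removes the multiples of the identity (`normalize_sub_normalize`), which gives
`logicalError_outputError_sub`.

Conditioning on syndromes rests on extremality of maps with a single Kraus operator: if the whole
ideal gate acts as `g` on an error, each of its Kraus operators acts as a multiple of `g`, and so
does every restriction to a set of syndromes. Uniqueness of the P2LC output holds because two Pauli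
errors act on the code space either identically or orthogonally, so the only ambiguity in the Pauli
coefficients lies among errors with the same action.

Orders are tested against linear functionals, so no norm on superoperators has to be chosen and
linear maps preserve orders trivially. -/

namespace FTQC

noncomputable section

/-! ### Orders of vector-valued functions near `0⁺` -/

section Order

variable {M N P : Type*} [AddCommGroup M] [Module ℂ M] [AddCommGroup N] [Module ℂ N]
  [AddCommGroup P] [Module ℂ P]

/-- `f ε = O(ε ^ m)` as `ε → 0⁺`, tested against all linear functionals. -/
def IsOrd (m : ℕ) (f : ℝ → M) : Prop :=
  ∀ l : M →ₗ[ℂ] ℂ, (fun ε => l (f ε)) =O[𝓝[>] (0 : ℝ)] fun ε => ε ^ m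

theorem isOrd_scalar {m : ℕ} {f : ℝ → ℂ} :
    IsOrd m f ↔ f =O[𝓝[>] (0 : ℝ)] fun ε => ε ^ m := by
  refine ⟨fun h => h LinearMap.id, fun h l => ?_⟩
  have : (fun ε => l (f ε)) = fun ε => l 1 * f ε := by
    funext ε
    have := l.map_smul (f ε) 1
    simpa [mul_comm] using this
  rw [this]
  exact h.const_mul_left _

theorem pow_isBigO_pow {m l : ℕ} (h : m ≤ l) :
    (fun ε : ℝ => ε ^ l) =O[𝓝[>] (0 : ℝ)] fun ε => ε ^ m :=
  Asymptotics.IsBigO.of_bound 1 (by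
    have : Tendsto (fun ε : ℝ => ε) (𝓝[>] 0) (𝓝 0) := nhdsWithin_le_nhds
    filter_upwards [self_mem_nhdsWithin, this.eventually (ge_mem_nhds zero_lt_one)] with ε h0 h1
    have h0 : 0 < ε := h0
    simpa [abs_of_pos h0] using pow_le_pow_of_le_one h0.le h1 h)

namespace IsOrd

variable {m l : ℕ} {f g : ℝ → M}

theorem mono (h : IsOrd l f) (hml : m ≤ l) : IsOrd m f :=
  fun φ => (h φ).trans (pow_isBigO_pow hml)

theorem add (hf : IsOrd m f) (hg : IsOrd m g) : IsOrd m fun ε => f ε + g ε := by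
  intro φ
  simpa using (hf φ).add (hg φ)

theorem neg (hf : IsOrd m f) : IsOrd m fun ε => -f ε := by
  intro φ
  simpa using (hf φ)

theorem sub (hf : IsOrd m f) (hg : IsOrd m g) : IsOrd m fun ε => f ε - g ε := by
  intro φ
  simpa using (hf φ).sub (hg φ)

theorem zero : IsOrd m fun _ => (0 : M) := by
  intro φ
  simpa using Asymptotics.isBigO_zero _ _

theorem sum {ι : Type*} {s : Finset ι} {f : ι → ℝ → M} (h : ∀ i ∈ s, IsOrd m (f i)) :
    IsOrd m fun ε => ∑ i ∈ s, f i ε := by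
  intro φ
  simpa using Asymptotics.IsBigO.fun_sum fun i hi => h i hi φ

theorem const (x : M) : IsOrd 0 fun _ => x := by
  intro φ
  simpa using Asymptotics.isBigO_const_const (φ x) (one_ne_zero (α := ℝ)) _

theorem map (T : M →ₗ[ℂ] N) (h : IsOrd m f) : IsOrd m fun ε => T (f ε) :=
  fun φ => h (φ ∘ₗ T)

theorem congr (h : IsOrd m f) (hfg : ∀ᶠ ε in 𝓝[>] (0 : ℝ), f ε = g ε) : IsOrd m g := by
  intro φ
  refine (h φ).congr' ?_ EventuallyEq.rfl
  filter_upwards [hfg] with ε hε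
  rw [hε]

theorem smul {a : ℝ → ℂ} (ha : IsOrd m a) (hf : IsOrd l f) :
    IsOrd (m + l) fun ε => a ε • f ε := by
  intro φ
  simpa [pow_add] using (isOrd_scalar.1 ha).mul (hf φ)

theorem mul {a b : ℝ → ℂ} (ha : IsOrd m a) (hb : IsOrd l b) :
    IsOrd (m + l) fun ε => a ε * b ε := by
  simpa using ha.smul hb

theorem smul_const {a : ℝ → ℂ} (ha : IsOrd m a) (x : M) : IsOrd m fun ε => a ε • x := by
  simpa using ha.smul (const x)

/-- Expanding the first argument in a basis reduces this to scalar multiples of linear images of the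
second. It is used for composition of superoperators. -/
theorem bilin [FiniteDimensional ℂ M] (B : M →ₗ[ℂ] N →ₗ[ℂ] P) {g : ℝ → N} (hf : IsOrd m f)
    (hg : IsOrd l g) : IsOrd (m + l) fun ε => B (f ε) (g ε) := by
  let b := Module.finBasis ℂ M
  have : (fun ε => B (f ε) (g ε)) = fun ε => ∑ i, b.coord i (f ε) • B (b i) (g ε) := by
    funext ε
    conv_lhs => rw [← b.sum_repr (f ε)]
    simp only [map_sum, map_smul, LinearMap.sum_apply, LinearMap.smul_apply,
      Module.Basis.coord_apply]
  rw [this]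
  exact sum fun i _ => (hf.map (b.coord i)).smul (hg.map (B (b i)))

theorem isBigO {E : Type*} [NormedAddCommGroup E] [NormedSpace ℂ E] [FiniteDimensional ℂ E]
    {f : ℝ → E} (h : IsOrd m f) : f =O[𝓝[>] (0 : ℝ)] fun ε => ε ^ m := by
  let b := Module.finBasis ℂ E
  have : f = fun ε => ∑ i, b.coord i (f ε) • b i := by
    funext ε
    conv_lhs => rw [← b.sum_repr (f ε)]
    simp
  rw [this]
  refine Asymptotics.IsBigO.fun_sum fun i _ => ?_
  have h1 := (h (b.coord i)).smul (Asymptotics.isBigO_const_const (b i) (one_ne_zero (α := ℝ))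
    (𝓝[>] (0 : ℝ)))
  simpa using h1

theorem of_isBigO {E : Type*} [NormedAddCommGroup E] [NormedSpace ℂ E] [FiniteDimensional ℂ E]
    {f : ℝ → E} (h : f =O[𝓝[>] (0 : ℝ)] fun ε => ε ^ m) : IsOrd m f := by
  intro φ
  exact ((LinearMap.toContinuousLinearMap φ).isBigO_comp f _).trans h

theorem tendsto_zero {E : Type*} [NormedAddCommGroup E] [NormedSpace ℂ E]
    [FiniteDimensional ℂ E] {f : ℝ → E} (h : IsOrd m f) (hm : 1 ≤ m) :
    Tendsto f (𝓝[>] 0) (𝓝 0) := by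
  refine (h.mono hm).isBigO.trans_tendsto ?_
  simp only [pow_one]
  exact nhdsWithin_le_nhds

theorem of_sub_const {x : M} (h : IsOrd m fun ε => f ε - x) : IsOrd 0 f := by
  simpa using (h.mono (Nat.zero_le m)).add (const x)

theorem eventually_ne {a : ℝ → ℂ} {q : ℂ} (h : IsOrd 1 fun ε => a ε - q) (hq : q ≠ 0) :
    ∀ᶠ ε in 𝓝[>] (0 : ℝ), a ε ≠ 0 := by
  have h1 : Tendsto a (𝓝[>] 0) (𝓝 q) := by
    simpa using (h.tendsto_zero le_rfl).add_const q
  exact h1.eventually_ne hq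

theorem inv {a : ℝ → ℂ} {q : ℂ} (h : IsOrd 1 fun ε => a ε - q) (hq : q ≠ 0) :
    IsOrd 1 fun ε => (a ε)⁻¹ - q⁻¹ := by
  have h1 : Tendsto a (𝓝[>] 0) (𝓝 q) := by
    simpa using (h.tendsto_zero le_rfl).add_const q
  have h2 : IsOrd 0 fun ε => (a ε)⁻¹ :=
    isOrd_scalar.2 (by simpa using (h1.inv₀ hq).isBigO_one ℝ)
  -- The identity behind this is `a⁻¹ - q⁻¹ = -(a - q) * a⁻¹ * q⁻¹`, with `a⁻¹` bounded near `0`.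
  have h3 := (h.neg.mul h2).mul (const q⁻¹)
  refine h3.congr ?_
  filter_upwards [h.eventually_ne hq] with ε hε
  field_simp
  ring

theorem ringInverse_of_normed {R : Type*} [NormedRing R] [NormedAlgebra ℂ R]
    [FiniteDimensional ℂ R] {f : ℝ → R} (h : IsOrd m fun ε => f ε - 1) (hm : 1 ≤ m) :
    (∀ᶠ ε in 𝓝[>] (0 : ℝ), IsUnit (f ε)) ∧ IsOrd m fun ε => Ring.inverse (f ε) - 1 := by
  have : CompleteSpace R := FiniteDimensional.complete ℂ R
  have h0 := h.tendsto_zero hm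
  have h1 : Tendsto f (𝓝[>] 0) (𝓝 ((1 : Rˣ) : R)) := by
    simpa using h0.add_const 1
  refine ⟨h1 (Units.nhds 1), of_isBigO ?_⟩
  have h2 := (NormedRing.inverse_add_norm_diff_first_order (1 : Rˣ)).comp_tendsto h0
  have h3 : (fun ε => Ring.inverse (f ε) - 1) =O[𝓝[>] (0 : ℝ)] fun ε => ‖f ε - 1‖ := by
    simpa [Function.comp_def] using h2
  exact h3.trans h.isBigO.norm_left

/-- Endomorphisms are transported to matrices with the operator norm for the sup norm, a normed
algebra in which inversion is Lipschitz near `1`. -/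
theorem ringInverse [FiniteDimensional ℂ M] {f : ℝ → Module.End ℂ M}
    (h : IsOrd m fun ε => f ε - 1) (hm : 1 ≤ m) :
    (∀ᶠ ε in 𝓝[>] (0 : ℝ), IsUnit (f ε)) ∧ IsOrd m fun ε => Ring.inverse (f ε) - 1 := by
  let e := LinearMap.toMatrixAlgEquiv (Module.finBasis ℂ M)
  let _ := Matrix.linftyOpNormedRing (n := Fin (Module.finrank ℂ M)) (α := ℂ)
  let _ := Matrix.linftyOpNormedAlgebra (R := ℂ) (n := Fin (Module.finrank ℂ M)) (α := ℂ)
  have h1 : IsOrd m fun ε => e (f ε) - 1 := by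
    simpa using h.map e.toLinearMap
  obtain ⟨h2, h3⟩ := ringInverse_of_normed h1 hm
  have h4 : ∀ᶠ ε in 𝓝[>] (0 : ℝ), IsUnit (f ε) := by
    filter_upwards [h2] with ε hε
    simpa using hε
  refine ⟨h4, (h3.map e.symm.toLinearMap).congr ?_⟩
  filter_upwards [h4] with ε hε
  have h5 : e (Ring.inverse (f ε)) = Ring.inverse (e (f ε)) := by
    have h6 : e (Ring.inverse (f ε)) * e (f ε) = 1 := by
      rw [← map_mul, Ring.inverse_mul_cancel _ hε, map_one]
    have h7 := Ring.mul_inverse_cancel (e (f ε)) (hε.map e)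
    exact left_inv_eq_right_inv h6 h7
  simp only [← h5, AlgEquiv.toLinearMap_apply, map_sub, map_one, AlgEquiv.symm_apply_apply]

end IsOrd

theorem isOrd_ofReal : IsOrd 1 fun ε : ℝ => (ε : ℂ) :=
  isOrd_scalar.2 (Asymptotics.IsBigO.of_bound 1 (by simp))

end Order

/-! ### Normalization -/

/-- `prob` as a linear functional. -/
def probLin (k m : ℕ) : Super k m →ₗ[ℂ] ℂ where
  toFun M := prob M
  map_add' x y := by simp [prob, add_div]
  map_smul' c x := by simp [prob, mul_div_assoc]

@[simp] theorem probLin_apply {k m : ℕ} (M : Super k m) : probLin k m M = prob M := rfl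

theorem prob_smul {k m : ℕ} (c : ℂ) (M : Super k m) : prob (c • M) = c * prob M :=
  (probLin k m).map_smul c M

theorem prob_id {k : ℕ} : prob (LinearMap.id : Super k k) = 1 := by
  simp [prob]

/-- This allows the normalization of the output error to be dropped inside that of the logical
error. -/
theorem normalize_smul {k m : ℕ} {c : ℂ} (hc : c ≠ 0) (M : Super k m) :
    normalize (c • M) = normalize M := by
  rw [normalize, prob_smul, normalize, smul_smul, mul_inv_rev, mul_assoc, inv_mul_cancel₀ hc,
    mul_one]

section Normalize

variable {k m : ℕ} {M M' : ℝ → Super k k} {σ σ' : ℝ → ℂ} {q : ℂ}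

theorem isOrd_prob_sub (hm : 1 ≤ m) (h : IsOrd m fun ε => M ε - σ ε • LinearMap.id)
    (hσ : IsOrd 1 fun ε => σ ε - q) : IsOrd 1 fun ε => prob (M ε) - q := by
  refine (((h.map (probLin k k)).mono hm).add hσ).congr (Eventually.of_forall fun ε => ?_)
  simp [-probLin_apply, map_sub, map_smul]
  simp [prob_id]

/-- Since the identity has `prob` equal to `1`, the scalar part `σ` cancels, and up to the factor
`(prob M)⁻¹` the deviation from the identity is linear in the remainder `M - σ • id`. -/
theorem normalize_sub_id (hm : 1 ≤ m) (hq : q ≠ 0)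
    (h : IsOrd m fun ε => M ε - σ ε • LinearMap.id)
    (hσ : IsOrd 1 fun ε => σ ε - q) :
    (∀ᶠ ε in 𝓝[>] (0 : ℝ), normalize (M ε) - LinearMap.id = (prob (M ε))⁻¹ •
      ((M ε - σ ε • LinearMap.id) - prob (M ε - σ ε • LinearMap.id) • LinearMap.id)) ∧
    IsOrd m fun ε => normalize (M ε) - LinearMap.id := by
  have h1 := isOrd_prob_sub hm h hσ
  have h2 : ∀ᶠ ε in 𝓝[>] (0 : ℝ), normalize (M ε) - LinearMap.id = (prob (M ε))⁻¹ •
      ((M ε - σ ε • LinearMap.id) - prob (M ε - σ ε • LinearMap.id) • LinearMap.id) := by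
    filter_upwards [h1.eventually_ne hq] with ε hε
    have h3 : prob (M ε - σ ε • LinearMap.id) = prob (M ε) - σ ε := by
      have := (probLin k k).map_sub (M ε) (σ ε • LinearMap.id)
      simpa [prob_smul, prob_id] using this
    rw [h3, normalize]
    have : (LinearMap.id : Super k k) = (prob (M ε))⁻¹ • (prob (M ε) • LinearMap.id) := by
      rw [smul_smul, inv_mul_cancel₀ hε, one_smul]
    conv_lhs => rw [this]
    module
  refine ⟨h2, ?_⟩
  have h4 := (h1.inv hq).of_sub_const.smul
    (h.sub ((h.map (probLin k k)).smul_const (LinearMap.id : Super k k)))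
  rw [zero_add] at h4
  refine h4.congr ?_
  filter_upwards [h2] with ε hε
  rw [hε]
  rfl

/-- The scalar parts need to agree only in the limit `q`; their difference at higher orders is
invisible after normalization. -/
theorem normalize_sub_normalize (hm : 1 ≤ m) (hq : q ≠ 0)
    (h : IsOrd m fun ε => M ε - σ ε • LinearMap.id)
    (hσ : IsOrd 1 fun ε => σ ε - q)
    (hσ' : IsOrd 1 fun ε => σ' ε - q)
    (hd : IsOrd (m + 1) fun ε => (M ε - M' ε) - (σ ε - σ' ε) • LinearMap.id) :
    IsOrd (m + 1) fun ε => normalize (M ε) - normalize (M' ε) := by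
  have h' : IsOrd m fun ε => M' ε - σ' ε • LinearMap.id := by
    have := h.sub (hd.mono (Nat.le_succ m))
    refine this.congr (Eventually.of_forall fun ε => ?_)
    module
  obtain ⟨e, -⟩ := normalize_sub_id hm hq h hσ
  obtain ⟨e', -⟩ := normalize_sub_id hm hq h' hσ'
  have p := isOrd_prob_sub hm h hσ
  have p' := isOrd_prob_sub hm h' hσ'
  have hinv : IsOrd 1 fun ε => (prob (M ε))⁻¹ - (prob (M' ε))⁻¹ := by
    refine ((p.inv hq).sub (p'.inv hq)).congr (Eventually.of_forall fun ε => ?_)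
    ring
  -- With remainders `R`, `R'` stripped of their `prob` and factors `p`, `p'`, the split is `p⁻¹ R -
  -- p'⁻¹ R' = p⁻¹ (R - R') + (p⁻¹ - p'⁻¹) R'`; the second term has order `1 + m`.
  have t1 := (p.inv hq).of_sub_const.smul
    (hd.sub ((hd.map (probLin k k)).smul_const (LinearMap.id : Super k k)))
  have t2 := hinv.smul (h'.sub ((h'.map (probLin k k)).smul_const (LinearMap.id : Super k k)))
  rw [zero_add] at t1
  rw [add_comm] at t2
  refine (t1.add t2).congr ?_
  filter_upwards [e, e'] with ε hε hε'
  have : normalize (M ε) - normalize (M' ε) =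
      (normalize (M ε) - LinearMap.id) - (normalize (M' ε) - LinearMap.id) := by abel
  rw [this, hε, hε']
  have hp : prob (M ε - M' ε - (σ ε - σ' ε) • LinearMap.id) =
      prob (M ε - σ ε • LinearMap.id) - prob (M' ε - σ' ε • LinearMap.id) := by
    simp only [← probLin_apply]
    rw [← map_sub]
    congr 1
    module
  simp only [probLin_apply]
  rw [hp]
  module

end Normalize

/-! ### Norm and infidelity -/

theorem superNorm_isBigO {k m : ℕ} {f : ℝ → Super k k} (h : IsOrd m f) :
    (fun ε => superNorm (f ε)) =O[𝓝[>] (0 : ℝ)] fun ε => ε ^ m := by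
  refine Asymptotics.IsBigO.fun_sum fun a _ => Asymptotics.IsBigO.fun_sum fun b _ =>
    Asymptotics.IsBigO.fun_sum fun c _ => Asymptotics.IsBigO.fun_sum fun d _ => ?_
  let φ : Super k k →ₗ[ℂ] ℂ :=
    { toFun := fun Λ => Λ (Matrix.single a b 1) c d
      map_add' := fun _ _ => rfl
      map_smul' := fun _ _ => rfl }
  exact (h φ).norm_left

theorem infidelity_isBigO {k m : ℕ} {f : ℝ → Super k k}
    (h : IsOrd m fun ε => f ε - LinearMap.id) :
    (fun ε => infidelity (f ε)) =O[𝓝[>] (0 : ℝ)] fun ε => ε ^ m := by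
  let φ : Super k k →ₗ[ℂ] ℂ :=
    { toFun := fun Λ => (∑ a, ∑ b, Λ (Matrix.single a b 1) a b) / (Fintype.card (Bits k) : ℂ) ^ 2
      map_add' := fun x y => by simp [Finset.sum_add_distrib, add_div]
      map_smul' := fun c x => by simp [← Finset.mul_sum, mul_div_assoc] }
  have hid : φ LinearMap.id = 1 := by
    have h0 : (Fintype.card (Bits k) : ℂ) ≠ 0 := Nat.cast_ne_zero.mpr Fintype.card_ne_zero
    have : φ LinearMap.id = ((Fintype.card (Bits k) : ℂ) * Fintype.card (Bits k)) /
        (Fintype.card (Bits k) : ℂ) ^ 2 := by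
      simp [φ]
    rw [this, sq, div_self (mul_ne_zero h0 h0)]
  have h1 : ∀ ε, infidelity (f ε) = -(φ (f ε - LinearMap.id)).re := by
    intro ε
    rw [map_sub, hid, Complex.sub_re, Complex.one_re, neg_sub]
    rfl
  simp_rw [h1]
  refine Asymptotics.IsBigO.neg_left (Asymptotics.IsBigO.trans ?_ (h φ))
  exact Asymptotics.IsBigO.of_bound 1 (Eventually.of_forall fun ε => by
    rw [one_mul]
    exact Complex.abs_re_le_norm _)

/-! ### Kraus operators -/

section Kraus

variable {ι κ μ : Type*} [Fintype κ] [Fintype μ]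

theorem conjBy_apply (K : Matrix ι κ ℂ) (ρ : Op κ) : conjBy K ρ = K * ρ * Kᴴ := rfl

theorem conjBy_comp (K : Matrix ι κ ℂ) (L : Matrix κ μ ℂ) :
    conjBy K ∘ₗ conjBy L = conjBy (K * L) := by
  ext1 ρ
  simp [conjBy_apply, Matrix.conjTranspose_mul, Matrix.mul_assoc]

theorem conjBy_one [Fintype ι] [DecidableEq ι] : conjBy (1 : Matrix ι ι ℂ) = LinearMap.id := by
  ext1 ρ
  simp [conjBy_apply]

theorem conjBy_smul (c : ℂ) (K : Matrix ι κ ℂ) :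
    conjBy (c • K) = ((‖c‖ ^ 2 : ℝ) : ℂ) • conjBy K := by
  ext1 ρ
  rw [LinearMap.smul_apply]
  simp only [conjBy_apply, Matrix.conjTranspose_smul, Matrix.smul_mul, Matrix.mul_smul, smul_smul]
  congr 1
  rw [← Complex.normSq_eq_norm_sq, Complex.normSq_eq_conj_mul_self]
  rfl

variable [Fintype ι]

/-- The Choi matrix of a superoperator, as a quadratic form on operators. -/
def choi [DecidableEq κ] (v : Matrix ι κ ℂ) : (Op κ →ₗ[ℂ] Op ι) →ₗ[ℂ] ℂ where
  toFun T := ∑ a, ∑ b, ∑ i, ∑ j, star (v i a) * v j b * T (Matrix.single a b 1) i j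
  map_add' x y := by simp [mul_add, Finset.sum_add_distrib]
  map_smul' c x := by
    simp only [LinearMap.smul_apply, Matrix.smul_apply, smul_eq_mul, RingHom.id_apply,
      Finset.mul_sum]
    simp only [mul_left_comm]

/-- A Kraus operator contributes the squared modulus of a Hilbert–Schmidt inner product. This
nonnegativity drives extremality. -/
theorem choi_conjBy [DecidableEq κ] (v K : Matrix ι κ ℂ) :
    choi v (conjBy K) = ((‖(vᴴ * K).trace‖ ^ 2 : ℝ) : ℂ) := by
  have h1 : ∀ a b i j, conjBy K (Matrix.single a b 1) i j = K i a * star (K j b) := by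
    intro a b i j
    rw [conjBy_apply, Matrix.mul_apply, Finset.sum_eq_single b]
    · simp [Matrix.mul_apply, Matrix.single_apply]
    · intro c _ hc
      simp [Matrix.mul_apply, hc.symm]
    · simp
  have h2 : (vᴴ * K).trace = ∑ a, ∑ i, star (v i a) * K i a := by
    simp [Matrix.trace, Matrix.mul_apply]
  rw [← Complex.normSq_eq_norm_sq, Complex.normSq_eq_conj_mul_self, h2, mul_comm]
  change (∑ a, ∑ b, ∑ i, ∑ j, star (v i a) * v j b * conjBy K (Matrix.single a b 1) i j) = _
  rw [map_sum, Finset.sum_mul_sum]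
  refine Finset.sum_congr rfl fun a _ => Finset.sum_congr rfl fun b _ => ?_
  rw [map_sum, Finset.sum_mul_sum]
  refine Finset.sum_congr rfl fun i _ => Finset.sum_congr rfl fun j _ => ?_
  rw [h1]
  simp
  ring

open scoped ComplexOrder in
theorem eq_zero_of_trace_conjTranspose_mul_self {v : Matrix ι κ ℂ} (h : (vᴴ * v).trace = 0) :
    v = 0 :=
  Matrix.trace_conjTranspose_mul_self_eq_zero_iff.1 h

/-- Extremality: the Kraus operators of a map with a single Kraus operator `U` are multiples of
`U`. -/
theorem exists_smul_of_sum_conjBy_eq [DecidableEq κ] {α : Type*} {s : Finset α}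
    {K : α → Matrix ι κ ℂ} {U : Matrix ι κ ℂ} (h : ∑ a ∈ s, conjBy (K a) = conjBy U) {b : α}
    (hb : b ∈ s) : ∃ c : ℂ, K b = c • U := by
  by_cases hU : U = 0
  · refine ⟨0, ?_⟩
    have h1 := congrArg (choi (K b)) h
    rw [map_sum, hU] at h1
    simp only [choi_conjBy] at h1
    rw [← Complex.ofReal_sum, Complex.ofReal_inj] at h1
    simp only [Matrix.mul_zero, Matrix.trace_zero, norm_zero, ne_eq, OfNat.ofNat_ne_zero,
      not_false_eq_true, zero_pow] at h1
    rw [Finset.sum_eq_zero_iff_of_nonneg fun _ _ => by positivity] at h1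
    rw [zero_smul]
    exact eq_zero_of_trace_conjTranspose_mul_self (by simpa using h1 b hb)
  · have hu : (Uᴴ * U).trace ≠ 0 := fun h0 => hU (eq_zero_of_trace_conjTranspose_mul_self h0)
    refine ⟨(Uᴴ * K b).trace / (Uᴴ * U).trace, ?_⟩
    set c := (Uᴴ * K b).trace / (Uᴴ * U).trace with hc
    -- Test with the component of `K b` orthogonal to `U`: the right-hand side vanishes, so every
    -- nonnegative term on the left does, and `v` is orthogonal to `K b` and to `U`, hence to
    -- itself.
    set v := K b - c • U with hv
    have hUv : (Uᴴ * v).trace = 0 := by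
      rw [hv, Matrix.mul_sub, Matrix.trace_sub, Matrix.mul_smul, Matrix.trace_smul, hc,
        smul_eq_mul, div_mul_cancel₀ _ hu, sub_self]
    have hvU : (vᴴ * U).trace = 0 := by
      have : (vᴴ * U) = (Uᴴ * v)ᴴ := by simp
      rw [this, Matrix.trace_conjTranspose, hUv, star_zero]
    have h1 := congrArg (choi v) h
    rw [map_sum] at h1
    simp only [choi_conjBy, hvU] at h1
    rw [← Complex.ofReal_sum, Complex.ofReal_inj] at h1
    simp only [norm_zero, ne_eq, OfNat.ofNat_ne_zero, not_false_eq_true, zero_pow] at h1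
    rw [Finset.sum_eq_zero_iff_of_nonneg fun _ _ => by positivity] at h1
    have h2 : (vᴴ * K b).trace = 0 := by simpa using h1 b hb
    have h3 : (vᴴ * v).trace = 0 := by
      conv_lhs => rw [hv]
      rw [Matrix.mul_sub, Matrix.trace_sub, Matrix.mul_smul, Matrix.trace_smul, ← hv, h2, hvU]
      simp
    exact sub_eq_zero.1 (eq_zero_of_trace_conjTranspose_mul_self h3)

end Kraus

/-! ### Instruments -/

/-- Complete positivity, in Kraus form. -/
def IsCP {n m : ℕ} (T : Super n m) : Prop :=
  ∃ (r : ℕ) (K : Fin r → Matrix (Bits m) (Bits n) ℂ), T = ∑ a, conjBy (K a)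

/-- Trace preservation. -/
def IsTP {n m : ℕ} (T : Super n m) : Prop := ∀ ρ, (T ρ).trace = ρ.trace

theorem IsCP.comp {n m l : ℕ} {T : Super m l} {T' : Super n m} (h : IsCP T) (h' : IsCP T') :
    IsCP (T ∘ₗ T') := by
  obtain ⟨r, K, rfl⟩ := h
  obtain ⟨r', K', rfl⟩ := h'
  refine ⟨r * r', fun i => K (finProdFinEquiv.symm i).1 * K' (finProdFinEquiv.symm i).2, ?_⟩
  rw [finProdFinEquiv.symm.sum_comp fun p : Fin r × Fin r' => conjBy (K p.1 * K' p.2),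
    Fintype.sum_prod_type]
  ext1 ρ
  simp only [LinearMap.comp_apply, LinearMap.sum_apply, map_sum, ← conjBy_comp]
  rw [Finset.sum_comm]

theorem IsTP.comp {n m l : ℕ} {T : Super m l} {T' : Super n m} (h : IsTP T) (h' : IsTP T') :
    IsTP (T ∘ₗ T') := fun ρ => (h _).trans (h' ρ)

theorem IsInstrument.isCP {n m : ℕ} {S : Type*} [Fintype S] {T : S → Super n m}
    (h : IsInstrument T) (s : S) : IsCP (T s) := by
  obtain ⟨r, K, hK, -⟩ := h
  exact ⟨r, K s, hK s⟩

theorem IsInstrument.isTP {n m : ℕ} {S : Type*} [Fintype S] {T : S → Super n m}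
    (h : IsInstrument T) : IsTP (∑ s, T s) := by
  obtain ⟨r, K, hK, h1⟩ := h
  intro ρ
  have h2 : ∀ s a, (conjBy (K s a) ρ).trace = ((K s a)ᴴ * K s a * ρ).trace := by
    intro s a
    rw [conjBy_apply, Matrix.trace_mul_comm, Matrix.mul_assoc]
  simp only [hK, LinearMap.sum_apply, Matrix.trace_sum, h2]
  simp only [← Matrix.trace_sum, ← Finset.sum_mul, h1, one_mul]

theorem IsChannel.isCP {n m : ℕ} {T : Super n m} (h : IsChannel T) : IsCP T :=
  IsInstrument.isCP h ()

theorem IsChannel.isTP {n m : ℕ} {T : Super n m} (h : IsChannel T) : IsTP T := by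
  simpa using IsInstrument.isTP h

theorem foldl_comp_induction {n m : ℕ} {p : Super n m → Prop} {q : Super m m → Prop}
    (hpq : ∀ T T', q T → p T' → p (T ∘ₗ T')) :
    ∀ {L : ℕ} {f : Fin L → Super m m} {x : Super n m}, (∀ l, q (f l)) → p x →
      p (Fin.foldl L (fun T l => f l ∘ₗ T) x)
  | 0, f, x, _, hx => by simpa using hx
  | L + 1, f, x, hf, hx => by
    rw [Fin.foldl_succ_last]
    exact hpq _ _ (hf _) (foldl_comp_induction hpq (fun l => hf _) hx)

section Gate

variable {n k : ℕ} {S : Type*} [Fintype S] (G : Gate n k S)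

theorem Gate.isCP_ideal_single (s : S) : IsCP (G.run (fun _ => LinearMap.id) s) :=
  (G.final_instrument.isCP s).comp
    (foldl_comp_induction (f := fun l => G.step l ∘ₗ LinearMap.id) (fun _ _ => IsCP.comp)
      (fun l => (G.step_channel l).isCP) G.init_channel.isCP)

theorem Gate.ideal_univ_isTP : IsTP (G.ideal Finset.univ) := by
  have h : IsTP (Fin.foldl G.locs (fun T l => (G.step l ∘ₗ LinearMap.id) ∘ₗ T) G.init) :=
    foldl_comp_induction (fun _ _ => IsTP.comp) (fun l => (G.step_channel l).isTP)
      G.init_channel.isTP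
  intro ρ
  rw [← h ρ, ← G.final_instrument.isTP]
  simp only [Gate.ideal, Gate.run, LinearMap.sum_apply]
  rfl

variable {G}

/-- One Kraus family serves all syndrome sets: conditioning selects a subfamily, so what holds for
each Kraus operator of the whole gate passes to every restriction. -/
theorem Gate.exists_kraus : ∃ (r : S → ℕ) (K : (Σ s, Fin (r s)) → Matrix (Bits n) (Bits n) ℂ),
    ∀ A : Finset S, G.ideal A = ∑ x ∈ A.sigma fun _ => Finset.univ, conjBy (K x) := by
  choose r K hK using G.isCP_ideal_single
  refine ⟨r, fun x => K x.1 x.2, fun A => ?_⟩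
  rw [Finset.sum_sigma]
  exact Finset.sum_congr rfl fun s _ => hK s

variable {W : Matrix (Bits n) (Bits k) ℂ}

theorem g_comp_gInv : G.g ∘ₗ G.gInv = LinearMap.id := by
  rw [Gate.g, Gate.gInv, conjBy_comp, ← Matrix.star_eq_conjTranspose,
    Unitary.mul_star_self_of_mem G.logical.2, conjBy_one]

theorem gInv_comp_g : G.gInv ∘ₗ G.g = LinearMap.id := by
  rw [Gate.g, Gate.gInv, conjBy_comp, ← Matrix.star_eq_conjTranspose,
    Unitary.star_mul_self_of_mem G.logical.2, conjBy_one]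

theorem dec_comp_enc (hW : Wᴴ * W = 1) : dec W ∘ₗ enc W = LinearMap.id := by
  rw [dec, enc, conjBy_comp, hW, conjBy_one]

/-- The ideal gate restricted to some syndromes still maps into the code space. -/
theorem Gate.Implements.enc_dec_ideal (h : G.Implements W) (hW : Wᴴ * W = 1) (A : Finset S) :
    enc W ∘ₗ dec W ∘ₗ G.ideal A = G.ideal A := by
  obtain ⟨r, K, hK⟩ := G.exists_kraus
  -- Projecting onto the complement of the code kills the whole gate; extremality with the single
  -- Kraus operator `0` then kills each Kraus operator separately.
  have h0 : conjBy (1 - W * Wᴴ) ∘ₗ G.ideal Finset.univ = conjBy (0 : Matrix _ _ ℂ) := by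
    ext1 X
    obtain ⟨ρ, hρ⟩ := h.2 X
    have h1 : (1 - W * Wᴴ) * W = 0 := by
      rw [Matrix.sub_mul, Matrix.mul_assoc, hW]
      simp
    rw [LinearMap.comp_apply, hρ, enc, ← LinearMap.comp_apply, conjBy_comp, h1]
    simp [conjBy_apply]
  have h2 : ∀ x, W * Wᴴ * K x = K x := by
    intro x
    rw [hK] at h0
    have h3 : ∑ x ∈ Finset.univ.sigma fun _ => Finset.univ, conjBy ((1 - W * Wᴴ) * K x) =
        conjBy 0 := by
      rw [← h0]
      ext1 ρ
      simp [LinearMap.sum_apply, map_sum, ← conjBy_comp]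
    obtain ⟨c, hc⟩ := exists_smul_of_sum_conjBy_eq h3 (b := x) (by simp)
    rw [smul_zero, Matrix.sub_mul, sub_eq_zero, Matrix.one_mul] at hc
    exact hc.symm
  rw [hK]
  ext1 ρ
  simp only [LinearMap.comp_apply, LinearMap.sum_apply, map_sum]
  refine Finset.sum_congr rfl fun x _ => ?_
  rw [enc, dec, ← LinearMap.comp_apply, conjBy_comp, ← LinearMap.comp_apply, conjBy_comp, h2]

/-- On a correctable error, the ideal gate restricted to some syndromes is proportional to the
logical gate. -/
theorem Gate.Correctable.exists_ideal {P : Pauli n} (h : G.Correctable W P) (hG : G.Implements W)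
    (hW : Wᴴ * W = 1) (A : Finset S) :
    ∃ q : ℝ, G.ideal A ∘ₗ pauliConj P ∘ₗ enc W = (q : ℂ) • (enc W ∘ₗ G.g) := by
  obtain ⟨r, K, hK⟩ := G.exists_kraus
  let U : Matrix (Bits k) (Bits k) ℂ := (G.logical : Op (Bits k))
  have h0 : dec W ∘ₗ G.ideal Finset.univ ∘ₗ pauliConj P ∘ₗ enc W = conjBy U := by
    ext1 ρ
    simp only [LinearMap.comp_apply]
    rw [h ρ, ← LinearMap.comp_apply, dec_comp_enc hW]
    rfl
  -- After decoding, the whole gate acts as the unitary `U`, so each Kraus operator is a multiple of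
  -- `U`; the factor for `A` sums the squared moduli over the syndromes in `A`.
  have h1 : ∀ x, ∃ c : ℂ, Wᴴ * (K x * (pauliMatrix P * W)) = c • U := by
    intro x
    rw [hK] at h0
    have h3 : ∑ x ∈ Finset.univ.sigma fun _ => Finset.univ,
        conjBy (Wᴴ * (K x * (pauliMatrix P * W))) = conjBy U := by
      rw [← h0]
      ext1 ρ
      simp [LinearMap.sum_apply, map_sum, ← conjBy_comp, dec, enc, pauliConj]
    exact exists_smul_of_sum_conjBy_eq h3 (b := x) (by simp)
  choose c hc using h1
  refine ⟨∑ x ∈ A.sigma fun _ => Finset.univ, ‖c x‖ ^ 2, ?_⟩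
  rw [← hG.enc_dec_ideal hW A]
  have h2 : dec W ∘ₗ G.ideal A ∘ₗ pauliConj P ∘ₗ enc W =
      ((∑ x ∈ A.sigma fun _ => Finset.univ, ‖c x‖ ^ 2 : ℝ) : ℂ) • G.g := by
    have : ∀ x, dec W ∘ₗ conjBy (K x) ∘ₗ pauliConj P ∘ₗ enc W = ((‖c x‖ ^ 2 : ℝ) : ℂ) • G.g := by
      intro x
      rw [dec, pauliConj, enc, conjBy_comp, conjBy_comp, conjBy_comp, hc, conjBy_smul]
      rfl
    rw [hK, Complex.ofReal_sum, Finset.sum_smul]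
    simp only [← this]
    ext1 ρ
    simp [LinearMap.sum_apply, map_sum]
  rw [LinearMap.comp_assoc, LinearMap.comp_assoc, h2, LinearMap.comp_smul]

end Gate

/-! ### Pauli operators -/

section Pauli

variable {n k : ℕ}

theorem pauliOne_conjTranspose (a : Fin 4) : (pauliOne a)ᴴ = pauliOne a := by
  ext i j
  fin_cases a <;> fin_cases i <;> fin_cases j <;> simp [pauliOne]

theorem pauliOne_mul (a b : Fin 4) : ∃ (e : ℕ) (c : Fin 4),
    pauliOne a * pauliOne b = Complex.I ^ e • pauliOne c := by
  have h2 : Complex.I ^ 2 = -1 := Complex.I_sq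
  have h3 : Complex.I ^ 3 = -Complex.I := by rw [pow_succ, h2]; simp
  fin_cases a <;> fin_cases b
  · exact ⟨0, 0, by ext i j; fin_cases i <;> fin_cases j <;> simp [pauliOne]⟩
  · exact ⟨0, 1, by ext i j; fin_cases i <;> fin_cases j <;> simp [pauliOne]⟩
  · exact ⟨0, 2, by ext i j; fin_cases i <;> fin_cases j <;> simp [pauliOne]⟩
  · exact ⟨0, 3, by ext i j; fin_cases i <;> fin_cases j <;> simp [pauliOne]⟩
  · exact ⟨0, 1, by ext i j; fin_cases i <;> fin_cases j <;> simp [pauliOne]⟩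
  · exact ⟨0, 0, by ext i j; fin_cases i <;> fin_cases j <;> simp [pauliOne]⟩
  · exact ⟨1, 3, by ext i j; fin_cases i <;> fin_cases j <;> simp [pauliOne]⟩
  · exact ⟨3, 2, by ext i j; fin_cases i <;> fin_cases j <;> simp [pauliOne, h3]⟩
  · exact ⟨0, 2, by ext i j; fin_cases i <;> fin_cases j <;> simp [pauliOne]⟩
  · exact ⟨3, 3, by ext i j; fin_cases i <;> fin_cases j <;> simp [pauliOne, h3]⟩
  · exact ⟨0, 0, by ext i j; fin_cases i <;> fin_cases j <;> simp [pauliOne]⟩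
  · exact ⟨1, 1, by ext i j; fin_cases i <;> fin_cases j <;> simp [pauliOne]⟩
  · exact ⟨0, 3, by ext i j; fin_cases i <;> fin_cases j <;> simp [pauliOne]⟩
  · exact ⟨1, 2, by ext i j; fin_cases i <;> fin_cases j <;> simp [pauliOne]⟩
  · exact ⟨3, 1, by ext i j; fin_cases i <;> fin_cases j <;> simp [pauliOne, h3]⟩
  · exact ⟨0, 0, by ext i j; fin_cases i <;> fin_cases j <;> simp [pauliOne]⟩

theorem pauliOne_mul_self (a : Fin 4) : pauliOne a * pauliOne a = 1 := by
  fin_cases a <;> ext i j <;> fin_cases i <;> fin_cases j <;> simp [pauliOne]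

theorem trace_pauliOne_mul {a b : Fin 4} (h : a ≠ b) :
    (pauliOne a * pauliOne b).trace = 0 := by
  fin_cases a <;> fin_cases b <;> first
    | exact absurd rfl h
    | simp [pauliOne, Matrix.trace]

theorem pauliMatrix_apply (P : Pauli n) (x y : Bits n) :
    pauliMatrix P x y = ∏ i, pauliOne (P i) (x i) (y i) := rfl

theorem pauliMatrix_mul_apply (P Q : Pauli n) (x y : Bits n) :
    (pauliMatrix P * pauliMatrix Q) x y = ∏ i, (pauliOne (P i) * pauliOne (Q i)) (x i) (y i) := by
  simp only [Matrix.mul_apply, pauliMatrix_apply, ← Finset.prod_mul_distrib,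
    Finset.prod_univ_sum, Fintype.piFinset_univ]

theorem pauliMatrix_conjTranspose (P : Pauli n) : (pauliMatrix P)ᴴ = pauliMatrix P := by
  ext x y
  rw [Matrix.conjTranspose_apply, pauliMatrix_apply, pauliMatrix_apply, star_prod]
  refine Finset.prod_congr rfl fun i _ => ?_
  rw [← Matrix.conjTranspose_apply, pauliOne_conjTranspose]

theorem prod_one_apply (x y : Bits n) :
    ∏ i, (1 : Matrix (Fin 2) (Fin 2) ℂ) (x i) (y i) = (1 : Op (Bits n)) x y := by
  by_cases h : x = y
  · subst h
    simp
  · rw [Matrix.one_apply_ne h]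
    obtain ⟨i, hi⟩ := Function.ne_iff.1 h
    exact Finset.prod_eq_zero (Finset.mem_univ i) (Matrix.one_apply_ne hi)

theorem pauliMatrix_zero : pauliMatrix (0 : Pauli n) = 1 := by
  ext x y
  rw [pauliMatrix_apply, ← prod_one_apply]
  rfl

theorem pauliConj_zero : pauliConj (0 : Pauli n) = LinearMap.id := by
  rw [pauliConj, pauliMatrix_zero, conjBy_one]

theorem pauliMatrix_mul_self (P : Pauli n) : pauliMatrix P * pauliMatrix P = 1 := by
  ext x y
  rw [pauliMatrix_mul_apply, ← prod_one_apply]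
  simp only [pauliOne_mul_self]

theorem pauliMatrix_mul (P Q : Pauli n) : ∃ (e : ℕ) (R : Pauli n),
    pauliMatrix P * pauliMatrix Q = Complex.I ^ e • pauliMatrix R := by
  choose e c h using fun i => pauliOne_mul (P i) (Q i)
  refine ⟨∑ i, e i, c, ?_⟩
  ext x y
  rw [pauliMatrix_mul_apply, Matrix.smul_apply, pauliMatrix_apply, smul_eq_mul,
    ← Finset.prod_pow_eq_pow_sum, ← Finset.prod_mul_distrib]
  refine Finset.prod_congr rfl fun i _ => ?_
  rw [h, Matrix.smul_apply, smul_eq_mul]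

theorem trace_pauliMatrix_mul {P Q : Pauli n} (h : P ≠ Q) :
    (pauliMatrix P * pauliMatrix Q).trace = 0 := by
  obtain ⟨i, hi⟩ := Function.ne_iff.1 h
  have : (pauliMatrix P * pauliMatrix Q).trace = ∏ i, (pauliOne (P i) * pauliOne (Q i)).trace := by
    simp only [Matrix.trace, Matrix.diag, pauliMatrix_mul_apply, Finset.prod_univ_sum,
      Fintype.piFinset_univ]
  rw [this]
  exact Finset.prod_eq_zero (Finset.mem_univ i) (trace_pauliOne_mul hi)

/-! ### The stabilizer group and the code projector -/

/-- Pauli operators with phases. -/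
def signedPauli (n : ℕ) : Set (Op (Bits n)) :=
  {m | ∃ (e : ℕ) (P : Pauli n), m = Complex.I ^ e • pauliMatrix P}

theorem signedPauli_finite : (signedPauli n).Finite := by
  refine (Set.finite_range fun x : Fin 4 × Pauli n =>
    Complex.I ^ (x.1 : ℕ) • pauliMatrix x.2).subset ?_
  rintro m ⟨e, P, rfl⟩
  refine ⟨(⟨e % 4, Nat.mod_lt _ (by norm_num)⟩, P), ?_⟩
  simp only
  congr 1
  conv_rhs => rw [← Nat.div_add_mod e 4, pow_add, pow_mul, Complex.I_pow_four, one_pow, one_mul]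

theorem signedPauli_mul {m m' : Op (Bits n)} (h : m ∈ signedPauli n) (h' : m' ∈ signedPauli n) :
    m * m' ∈ signedPauli n := by
  obtain ⟨e, P, rfl⟩ := h
  obtain ⟨e', P', rfl⟩ := h'
  obtain ⟨f, R, hR⟩ := pauliMatrix_mul P P'
  refine ⟨e + e' + f, R, ?_⟩
  rw [Matrix.smul_mul, Matrix.mul_smul, hR, smul_smul, smul_smul, pow_add, pow_add]

theorem star_I_pow (e : ℕ) : star (Complex.I ^ e) = Complex.I ^ (3 * e) := by
  have h3 : Complex.I ^ 3 = -Complex.I := by rw [pow_succ, Complex.I_sq]; simp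
  rw [star_pow, pow_mul, h3]
  simp

theorem signedPauli_conjTranspose {m : Op (Bits n)} (h : m ∈ signedPauli n) :
    mᴴ ∈ signedPauli n := by
  obtain ⟨e, P, rfl⟩ := h
  exact ⟨3 * e, P, by rw [Matrix.conjTranspose_smul, pauliMatrix_conjTranspose, star_I_pow]⟩

theorem signedPauli_conjTranspose_mul {m : Op (Bits n)} (h : m ∈ signedPauli n) :
    mᴴ * m = 1 := by
  obtain ⟨e, P, rfl⟩ := h
  rw [Matrix.conjTranspose_smul, pauliMatrix_conjTranspose, Matrix.smul_mul, Matrix.mul_smul,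
    pauliMatrix_mul_self, smul_smul, star_I_pow, ← pow_add,
    show 3 * e + e = 4 * e by ring, pow_mul, Complex.I_pow_four, one_pow, one_smul]

/-- The stabilizer group of the code, as matrices. -/
def stabilizers (W : Matrix (Bits n) (Bits k) ℂ) : Finset (Op (Bits n)) :=
  (signedPauli_finite.subset (Set.sep_subset (signedPauli n) fun m => m * W = W)).toFinset

theorem mem_stabilizers {W : Matrix (Bits n) (Bits k) ℂ} {m : Op (Bits n)} :
    m ∈ stabilizers W ↔ m ∈ signedPauli n ∧ m * W = W := by
  simp [stabilizers]

variable {W : Matrix (Bits n) (Bits k) ℂ}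

theorem sum_stabilizers_conjTranspose :
    (∑ m ∈ stabilizers W, m)ᴴ = ∑ m ∈ stabilizers W, m := by
  have hmem : ∀ m ∈ stabilizers W, mᴴ ∈ stabilizers W := by
    intro m hm
    rw [mem_stabilizers] at hm ⊢
    refine ⟨signedPauli_conjTranspose hm.1, ?_⟩
    conv_lhs => rw [← hm.2, ← Matrix.mul_assoc, signedPauli_conjTranspose_mul hm.1, Matrix.one_mul]
  rw [Matrix.conjTranspose_sum]
  exact Finset.sum_bij' (fun m _ => mᴴ) (fun m _ => mᴴ) hmem hmem (by simp) (by simp) (by simp)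

/-- Left multiplication by an involutive stabilizer is its own inverse and permutes the stabilizers.
-/
theorem mul_sum_stabilizers {s : Op (Bits n)} (hs : s ∈ stabilizers W) (hs2 : s * s = 1) :
    s * ∑ m ∈ stabilizers W, m = ∑ m ∈ stabilizers W, m := by
  have hmem : ∀ m ∈ stabilizers W, s * m ∈ stabilizers W := by
    intro m hm
    rw [mem_stabilizers] at hm hs ⊢
    exact ⟨signedPauli_mul hs.1 hm.1, by rw [Matrix.mul_assoc, hm.2, hs.2]⟩
  rw [Finset.mul_sum]
  exact Finset.sum_bij' (fun m _ => s * m) (fun m _ => s * m) hmem hmem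
    (fun m _ => by rw [← mul_assoc, hs2, one_mul]) (fun m _ => by rw [← mul_assoc, hs2, one_mul])
    (by simp)

/-- The code projector is the average of the stabilizer group. -/
theorem IsStabilizerCode.sum_stabilizers (hW : IsStabilizerCode W) :
    ∑ m ∈ stabilizers W, m = ((stabilizers W).card : ℂ) • (W * Wᴴ) := by
  obtain ⟨h1, T, hT⟩ := hW
  set A := ∑ m ∈ stabilizers W, m with hA
  have hAW : A * W = ((stabilizers W).card : ℂ) • W := by
    rw [hA, Matrix.sum_mul, Finset.sum_congr rfl fun m hm => (mem_stabilizers.1 hm).2]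
    simp [Nat.cast_smul_eq_nsmul]
  have hτ : ∀ τ ∈ T, (((τ.1 : ℤ) : ℂ)) • (pauliMatrix τ.2 * A) = A := by
    intro τ hτ
    have hs : ((τ.1 : ℤ) : ℂ) • pauliMatrix τ.2 ∈ stabilizers W := by
      rw [mem_stabilizers]
      refine ⟨?_, ?_⟩
      · rcases Int.units_eq_one_or τ.1 with h | h
        · exact ⟨0, τ.2, by simp [h]⟩
        · exact ⟨2, τ.2, by simp [h, Complex.I_sq]⟩
      · ext x y
        have := (hT (W *ᵥ Pi.single y 1)).1 ⟨_, rfl⟩ τ hτ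
        rw [Matrix.mulVec_mulVec, ← Matrix.smul_mulVec, ← Matrix.smul_mul] at this
        simpa using congrFun this x
    have hs2 : (((τ.1 : ℤ) : ℂ) • pauliMatrix τ.2) * (((τ.1 : ℤ) : ℂ) • pauliMatrix τ.2) = 1 := by
      rw [Matrix.smul_mul, Matrix.mul_smul, pauliMatrix_mul_self, smul_smul]
      rcases Int.units_eq_one_or τ.1 with h | h <;> simp [h]
    rw [← Matrix.smul_mul]
    exact mul_sum_stabilizers hs hs2
  -- The columns of `A` are fixed by the defining signed Paulis, hence lie in the code space.
  have hB : ∀ y, ∃ w, A *ᵥ Pi.single y 1 = W *ᵥ w := by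
    intro y
    refine (hT _).2 fun τ h => ?_
    rw [Matrix.mulVec_mulVec, ← Matrix.smul_mulVec, hτ τ h]
  choose B hB using hB
  have hAB : A = W * Matrix.of fun a y => B y a := by
    ext x y
    have := congrFun (hB y) x
    rw [Matrix.mulVec_single_one] at this
    exact this
  have h2 : W * Wᴴ * A = A := by
    conv_lhs => rw [hAB]
    rw [Matrix.mul_assoc, ← Matrix.mul_assoc Wᴴ, h1, Matrix.one_mul, ← hAB]
  -- As `A` is Hermitian, absorbing the projector on the left gives it on the right, where `A * W`
  -- is already known.
  have h3 : A * (W * Wᴴ) = A := by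
    have := congrArg Matrix.conjTranspose h2
    rw [Matrix.conjTranspose_mul, hA, sum_stabilizers_conjTranspose, ← hA] at this
    simpa using this
  rw [← h3, ← Matrix.mul_assoc, hAW, Matrix.smul_mul]

/-- Two Pauli errors act on the code space either equally up to a factor, or orthogonally. -/
theorem IsStabilizerCode.exists_smul_of_trace_ne_zero (hW : IsStabilizerCode W) {P Q : Pauli n}
    (h : ((pauliMatrix P * W)ᴴ * (pauliMatrix Q * W)).trace ≠ 0) :
    ∃ c : ℂ, pauliMatrix P * W = c • (pauliMatrix Q * W) := by
  have h1 : (pauliMatrix P * (pauliMatrix Q * (W * Wᴴ))).trace ≠ 0 := by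
    convert h using 1
    rw [Matrix.conjTranspose_mul, pauliMatrix_conjTranspose, Matrix.mul_assoc Wᴴ,
      Matrix.trace_mul_comm Wᴴ]
    simp only [Matrix.mul_assoc]
  have h2 : (pauliMatrix P * (pauliMatrix Q * ∑ m ∈ stabilizers W, m)).trace ≠ 0 := by
    rw [hW.sum_stabilizers, Matrix.mul_smul, Matrix.mul_smul, Matrix.trace_smul]
    refine smul_ne_zero (Nat.cast_ne_zero.2 (Finset.card_ne_zero.2 ⟨1, ?_⟩)) h1
    exact mem_stabilizers.2 ⟨⟨0, 0, by simp [pauliMatrix_zero]⟩, Matrix.one_mul W⟩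
  -- Some stabilizer `m` has `tr (P Q m) ≠ 0`. By trace orthogonality of Paulis, `Q m` is then `P`
  -- up to phase, and `m` acts trivially on `W`.
  rw [Finset.mul_sum, Finset.mul_sum, Matrix.trace_sum] at h2
  obtain ⟨m, hm, h3⟩ := Finset.exists_ne_zero_of_sum_ne_zero h2
  obtain ⟨hm1, hm2⟩ := mem_stabilizers.1 hm
  have hQ : pauliMatrix Q ∈ signedPauli n := ⟨0, Q, by simp⟩
  obtain ⟨e, R, hR⟩ := signedPauli_mul hQ hm1
  have hPR : P = R := by
    by_contra hne
    rw [hR, Matrix.mul_smul, Matrix.trace_smul, trace_pauliMatrix_mul hne, smul_zero] at h3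
    exact h3 rfl
  have hI : Complex.I ^ e ≠ 0 := pow_ne_zero _ Complex.I_ne_zero
  refine ⟨(Complex.I ^ e)⁻¹, ?_⟩
  rw [← hm2, ← Matrix.mul_assoc (pauliMatrix Q), hR, hPR, Matrix.smul_mul, smul_smul,
    inv_mul_cancel₀ hI, one_smul, hm2]

/-! ### Pauli channels on the code space -/

theorem trace_pauli_code (hW : Wᴴ * W = 1) (P : Pauli n) :
    ((pauliMatrix P * W)ᴴ * (pauliMatrix P * W)).trace = (Fintype.card (Bits k) : ℂ) := by
  rw [Matrix.conjTranspose_mul, pauliMatrix_conjTranspose, Matrix.mul_assoc,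
    ← Matrix.mul_assoc (pauliMatrix P), pauliMatrix_mul_self, Matrix.one_mul, hW, Matrix.trace_one]

theorem pauliConj_comp_enc (P : Pauli n) : pauliConj P ∘ₗ enc W = conjBy (pauliMatrix P * W) := by
  rw [pauliConj, enc, conjBy_comp]

/-- This orthogonality makes the Choi form at `Q W` read off the total coefficient of all errors
acting like `Q` on the code. -/
theorem choi_pauliConj_comp_enc (hW : IsStabilizerCode W) (P Q : Pauli n) [Decidable
    (pauliConj P ∘ₗ enc W = pauliConj Q ∘ₗ enc W)] :
    choi (pauliMatrix Q * W) (pauliConj P ∘ₗ enc W) =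
      if pauliConj P ∘ₗ enc W = pauliConj Q ∘ₗ enc W then (Fintype.card (Bits k) : ℂ) ^ 2
      else 0 := by
  have hself : ∀ R : Pauli n, choi (pauliMatrix R * W) (pauliConj R ∘ₗ enc W) =
      (Fintype.card (Bits k) : ℂ) ^ 2 := by
    intro R
    rw [pauliConj_comp_enc, choi_conjBy, trace_pauli_code hW.1]
    simp
  have h0 : (Fintype.card (Bits k) : ℂ) ^ 2 ≠ 0 :=
    pow_ne_zero _ (Nat.cast_ne_zero.mpr Fintype.card_ne_zero)
  split_ifs with h
  · rw [h, hself]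
  · by_contra hne
    rw [pauliConj_comp_enc, choi_conjBy] at hne
    have h1 : ((pauliMatrix Q * W)ᴴ * (pauliMatrix P * W)).trace ≠ 0 := by
      intro h2
      rw [h2] at hne
      simp at hne
    obtain ⟨c, hc⟩ := hW.exists_smul_of_trace_ne_zero h1
    have h2 : pauliConj Q ∘ₗ enc W = ((‖c‖ ^ 2 : ℝ) : ℂ) • (pauliConj P ∘ₗ enc W) := by
      rw [pauliConj_comp_enc, pauliConj_comp_enc, hc, conjBy_smul]
    -- Both `P W` and `Q W` have the same Hilbert–Schmidt norm, so the factor is a phase.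
    have h3 : ((‖c‖ ^ 2 : ℝ) : ℂ) = 1 := by
      have h4 := congrArg Matrix.trace (congrArg₂ (· * ·) (congrArg Matrix.conjTranspose hc) hc)
      simp only [Matrix.conjTranspose_smul, Matrix.smul_mul, Matrix.mul_smul, Matrix.trace_smul,
        trace_pauli_code hW.1, smul_eq_mul, ← mul_assoc] at h4
      have h5 : (Fintype.card (Bits k) : ℂ) ≠ 0 := Nat.cast_ne_zero.mpr Fintype.card_ne_zero
      have h6 := mul_right_cancel₀ h5 ((one_mul _).trans h4)
      rw [← Complex.normSq_eq_norm_sq, Complex.normSq_eq_conj_mul_self, h6, mul_comm]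
      rfl
    rw [h3, one_smul] at h2
    exact h h2.symm

/-- The coefficients of a Pauli channel on code states are determined up to the redistribution
among Pauli errors that act in the same way. -/
theorem sum_comp_eq_of_pauliChannel_eq (hW : IsStabilizerCode W) {p p' : Pauli n → ℝ}
    (h : pauliChannel W p = pauliChannel W p') (f : Super k n → Super k n) :
    ∑ P, (p P : ℂ) • f (pauliConj P ∘ₗ enc W) = ∑ P, (p' P : ℂ) • f (pauliConj P ∘ₗ enc W) := by
  classical
  have key : ∀ Q : Pauli n,
      ∑ P with pauliConj P ∘ₗ enc W = pauliConj Q ∘ₗ enc W, (p P : ℂ) =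
      ∑ P with pauliConj P ∘ₗ enc W = pauliConj Q ∘ₗ enc W, (p' P : ℂ) := by
    intro Q
    have h0 : (Fintype.card (Bits k) : ℂ) ^ 2 ≠ 0 :=
      pow_ne_zero _ (Nat.cast_ne_zero.mpr Fintype.card_ne_zero)
    have h1 := congrArg (choi (pauliMatrix Q * W)) h
    simp only [pauliChannel, map_sum, map_smul, choi_pauliConj_comp_enc hW, smul_eq_mul,
      mul_ite, mul_zero, ← Finset.sum_filter, ← Finset.sum_mul] at h1
    exact mul_right_cancel₀ h0 h1
  -- Group the Paulis by their action on the code; only the fibre totals enter, and `key` determines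
  -- these.
  have hfib : ∀ p : Pauli n → ℝ, ∑ P, (p P : ℂ) • f (pauliConj P ∘ₗ enc W) =
      ∑ T ∈ Finset.univ.image fun P : Pauli n => pauliConj P ∘ₗ enc W,
        (∑ P with pauliConj P ∘ₗ enc W = T, (p P : ℂ)) • f T := by
    intro p
    rw [← Finset.sum_fiberwise_of_maps_to (t := Finset.univ.image fun P : Pauli n =>
      pauliConj P ∘ₗ enc W) (g := fun P : Pauli n => pauliConj P ∘ₗ enc W)
      (fun P _ => Finset.mem_image_of_mem _ (Finset.mem_univ P))]
    refine Finset.sum_congr rfl fun T _ => ?_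
    rw [Finset.sum_smul]
    refine Finset.sum_congr rfl fun P hP => ?_
    rw [(Finset.mem_filter.1 hP).2]
  rw [hfib, hfib]
  refine Finset.sum_congr rfl fun T hT => ?_
  obtain ⟨Q, -, rfl⟩ := Finset.mem_image.1 hT
  rw [key]

/-- Whether an error is correctable depends only on its action on code states, so the replacement
rule is a function of that action. -/
theorem correctablePart_eq {S : Type*} [Fintype S] (hW : IsStabilizerCode W) {p p' : Pauli n → ℝ}
    (h : pauliChannel W p = pauliChannel W p') (G : Gate n k S) :
    correctablePart W G p = correctablePart W G p' := by
  classical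
  exact sum_comp_eq_of_pauliChannel_eq hW h fun T =>
    if ∀ ρ, G.ideal Finset.univ (T ρ) = enc W (G.g ρ) then T else enc W

theorem prob_pauliConj_comp_enc (hW : Wᴴ * W = 1) (P : Pauli n) :
    prob (pauliConj P ∘ₗ enc W) = 1 := by
  rw [pauliConj_comp_enc, prob, conjBy_apply, Matrix.mul_one, Matrix.trace_mul_comm,
    trace_pauli_code hW, div_self (Nat.cast_ne_zero.mpr Fintype.card_ne_zero)]

end Pauli

/-! ### Expansion of a faulty gate into fault-paths -/

namespace IsOrd

theorem prod {ι : Type*} {s : Finset ι} {m : ι → ℕ} {f : ι → ℝ → ℂ}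
    (h : ∀ i ∈ s, IsOrd (m i) (f i)) : IsOrd (∑ i ∈ s, m i) fun ε => ∏ i ∈ s, f i ε := by
  classical
  induction s using Finset.induction_on with
  | empty => simpa using const (1 : ℂ)
  | insert i s hi ih =>
    simp only [Finset.sum_insert hi, Finset.prod_insert hi]
    exact (h i (Finset.mem_insert_self i s)).mul
      (ih fun j hj => h j (Finset.mem_insert_of_mem hj))

theorem prod_sub_one {ι : Type*} {s : Finset ι} {f : ι → ℝ → ℂ}
    (h : ∀ i ∈ s, IsOrd 1 fun ε => f i ε - 1) : IsOrd 1 fun ε => (∏ i ∈ s, f i ε) - 1 := by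
  classical
  induction s using Finset.induction_on with
  | empty => simpa using zero (M := ℂ)
  | insert i s hi ih =>
    have h1 := h i (Finset.mem_insert_self i s)
    have h2 := ih fun j hj => h j (Finset.mem_insert_of_mem hj)
    refine ((h1.mul h2.of_sub_const).add h2).congr (Eventually.of_forall fun ε => ?_)
    rw [Finset.prod_insert hi]
    ring

end IsOrd

/-- Distributivity of composition over sums: one summand is chosen at each location. The induction
splits off the choice at the last location. -/
theorem foldl_sum {n m : ℕ} {α : Type*} [Fintype α] (φ : α → Super m m) (x : Super n m) :
    ∀ {L : ℕ} (f : Fin L → Super m m) (c : Fin L → α → ℂ),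
      Fin.foldl L (fun T l => f l ∘ₗ (∑ P, c l P • φ P) ∘ₗ T) x =
        ∑ F : Fin L → α, (∏ l, c l (F l)) • Fin.foldl L (fun T l => f l ∘ₗ φ (F l) ∘ₗ T) x
  | 0, f, c => by simp
  | L + 1, f, c => by
    rw [Fin.foldl_succ_last, foldl_sum φ x (fun l => f l.castSucc) fun l => c l.castSucc]
    rw [← (Fin.snocEquiv fun _ : Fin (L + 1) => α).sum_comp fun F => (∏ l, c l (F l)) •
      Fin.foldl (L + 1) (fun T l => f l ∘ₗ φ (F l) ∘ₗ T) x, Fintype.sum_prod_type]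
    ext1 ρ
    simp only [LinearMap.comp_apply, LinearMap.sum_apply, LinearMap.smul_apply, map_sum, map_smul,
      Finset.smul_sum, Fin.foldl_succ_last, Fin.snocEquiv_apply, Fin.prod_univ_castSucc,
      Fin.snoc_castSucc, Fin.snoc_last, smul_smul]
    exact Finset.sum_comm

namespace Gate

variable {n k : ℕ} {S : Type*} [Fintype S] (G : Gate n k S)

/-- The probability of a fault-path. -/
def pathProb (ε : ℝ) (F : Fin G.locs → Pauli G.reg) : ℝ :=
  ∏ l, if F l = 0 then 1 - ε else ε * G.fault l (F l)

/-- The gate with the faults of `F`, restricted to the runs with syndrome in `A`. -/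
def pathOp (A : Finset S) (F : Fin G.locs → Pauli G.reg) : Super n n := ∑ s ∈ A, G.runPath F s

theorem pathProb_nonneg {ε : ℝ} (h0 : 0 ≤ ε) (h1 : ε ≤ 1) (F : Fin G.locs → Pauli G.reg) :
    0 ≤ G.pathProb ε F := by
  refine Finset.prod_nonneg fun l _ => ?_
  split_ifs
  · linarith
  · exact mul_nonneg h0 (G.fault_nonneg _ _)

/-- Fault tolerance and the Pauli error hypothesis say nothing about forbidden fault-paths; this
removes them from the expansions. -/
theorem pathProb_eq_zero {F : Fin G.locs → Pauli G.reg} (h : ¬ G.IsFaultPath F) (ε : ℝ) :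
    G.pathProb ε F = 0 := by
  simp only [IsFaultPath, not_forall] at h
  obtain ⟨l, hl, hl'⟩ := h
  refine Finset.prod_eq_zero (Finset.mem_univ l) ?_
  rw [if_neg hl, le_antisymm (not_lt.1 hl') (G.fault_nonneg _ _), mul_zero]

theorem isOrd_one_sub : IsOrd 1 fun ε : ℝ => ((1 - ε : ℝ) : ℂ) - 1 := by
  refine isOrd_ofReal.neg.congr (Eventually.of_forall fun ε => ?_)
  push_cast
  ring

theorem pathProb_isOrd (F : Fin G.locs → Pauli G.reg) :
    IsOrd (G.numFaults F) fun ε => (G.pathProb ε F : ℂ) := by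
  have h : G.numFaults F = ∑ l, if F l ≠ 0 then 1 else 0 := by
    rw [numFaults, Finset.card_filter]
  simp only [pathProb, Complex.ofReal_prod]
  rw [h]
  refine IsOrd.prod fun l _ => ?_
  by_cases hl : F l = 0
  · simpa [hl] using isOrd_one_sub.of_sub_const
  · simpa [hl] using isOrd_ofReal.mul (IsOrd.const (G.fault l (F l) : ℂ))

theorem pathProb_zero_isOrd : IsOrd 1 fun ε => (G.pathProb ε 0 : ℂ) - 1 := by
  simp only [pathProb, Complex.ofReal_prod]
  refine IsOrd.prod_sub_one fun l _ => ?_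
  simpa using isOrd_one_sub

theorem isFaultPath_zero : G.IsFaultPath 0 := fun _ h => absurd rfl h

theorem numFaults_zero : G.numFaults 0 = 0 := by simp [numFaults]

theorem numFaults_pos {F : Fin G.locs → Pauli G.reg} (h : F ≠ 0) : 1 ≤ G.numFaults F := by
  obtain ⟨l, hl⟩ := Function.ne_iff.1 h
  exact Finset.card_pos.2 ⟨l, by simpa using hl⟩

theorem pathOp_zero (A : Finset S) : G.pathOp A 0 = G.ideal A := by
  simp [pathOp, ideal, runPath, pauliConj_zero]

theorem noisy_eq_sum (ε : ℝ) (A : Finset S) :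
    G.noisy ε A = ∑ F, (G.pathProb ε F : ℂ) • G.pathOp A F := by
  -- The no-fault branch is merged into the Pauli sum as the letter `0`, whose fault probability is
  -- zero.
  have h1 : ∀ l, G.faultChannel ε l =
      ∑ P, ((if P = 0 then 1 - ε else ε * G.fault l P : ℝ) : ℂ) • pauliConj P := by
    intro l
    rw [faultChannel, ← Finset.add_sum_erase _ _ (Finset.mem_univ (0 : Pauli G.reg)),
      ← Finset.add_sum_erase _ (fun P => ((if P = 0 then 1 - ε else ε * G.fault l P : ℝ) : ℂ) •
        pauliConj P) (Finset.mem_univ (0 : Pauli G.reg))]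
    rw [G.fault_zero, Complex.ofReal_zero, zero_smul, zero_add, if_pos rfl, pauliConj_zero,
      Finset.smul_sum]
    congr 1
    refine Finset.sum_congr rfl fun P hP => ?_
    rw [if_neg (Finset.ne_of_mem_erase hP), smul_smul, Complex.ofReal_mul]
  have h2 : ∀ s, G.run (G.faultChannel ε) s = ∑ F, (G.pathProb ε F : ℂ) • G.runPath F s := by
    intro s
    have := foldl_sum pauliConj G.init G.step
      fun l P => ((if P = 0 then 1 - ε else ε * G.fault l P : ℝ) : ℂ)
    simp only [run, runPath, h1, this, pathProb, Complex.ofReal_prod]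
    ext1 ρ
    simp only [LinearMap.comp_apply, LinearMap.sum_apply, LinearMap.smul_apply, map_sum, map_smul]
  simp only [noisy, h2, pathOp, Finset.smul_sum]
  exact Finset.sum_comm

end Gate

theorem weight_eq_zero {n : ℕ} {P : Pauli n} : weight P = 0 ↔ P = 0 := by
  simp [weight, Finset.card_eq_zero, Finset.filter_eq_empty_iff, funext_iff]

theorem weight_zero {n : ℕ} : weight (0 : Pauli n) = 0 := weight_eq_zero.2 rfl

/-! ### Consequences of fault tolerance for single fault-paths -/

namespace Gate

variable {n k t : ℕ} {S : Type*} [Fintype S] {G : Gate n k S} {W : Matrix (Bits n) (Bits k) ℂ}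
  {A : Finset S}

theorem sum_pauli_comp_gInv {T : Super n n} {X : Super k n} {r : Pauli n → ℝ}
    (h : ∀ ρ, T (X ρ) = ∑ Q, (r Q : ℂ) • pauliConj Q (enc W (G.g ρ))) :
    T ∘ₗ X ∘ₗ G.gInv = ∑ Q, (r Q : ℂ) • (pauliConj Q ∘ₗ enc W) := by
  ext1 ρ
  rw [LinearMap.comp_apply, LinearMap.comp_apply, h, ← LinearMap.comp_apply (f := G.g),
    g_comp_gInv]
  simp [LinearMap.sum_apply]

theorem sum_syndromes {F : Fin G.locs → Pauli G.reg} {X : Super k n} {p : S → Pauli n → ℝ}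
    (h : ∀ s ρ, G.runPath F s (X ρ) = ∑ Q, (p s Q : ℂ) • pauliConj Q (enc W (G.g ρ))) :
    G.pathOp A F ∘ₗ X ∘ₗ G.gInv =
      ∑ Q, ((∑ s ∈ A, p s Q : ℝ) : ℂ) • (pauliConj Q ∘ₗ enc W) := by
  refine sum_pauli_comp_gInv fun ρ => ?_
  simp only [pathOp, LinearMap.sum_apply, h, Complex.ofReal_sum, Finset.sum_smul]
  exact Finset.sum_comm

theorem IsFaultTolerant.exists_coeff (hFT : G.IsFaultTolerant W t) (A : Finset S) {E : Pauli n}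
    {F : Fin G.locs → Pauli G.reg} (hF : G.IsFaultPath F)
    (h : weight E + G.numFaults F ≤ t) :
    ∃ r : Pauli n → ℝ, (∀ Q, 0 ≤ r Q) ∧ (∀ Q, G.numFaults F < weight Q → r Q = 0) ∧
      G.pathOp A F ∘ₗ (pauliConj E ∘ₗ enc W) ∘ₗ G.gInv =
        ∑ Q, (r Q : ℂ) • (pauliConj Q ∘ₗ enc W) := by
  choose p hp0 hpw hp using hFT E F hF h
  exact ⟨fun Q => ∑ s ∈ A, p s Q, fun Q => Finset.sum_nonneg fun s _ => hp0 s Q,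
    fun Q hQ => Finset.sum_eq_zero fun s _ => hpw s Q hQ, sum_syndromes hp⟩

theorem HasPauliErrors.exists_coeff (hP : G.HasPauliErrors W) (A : Finset S)
    {F : Fin G.locs → Pauli G.reg} (hF : G.IsFaultPath F) :
    ∃ r : Pauli n → ℝ, (∀ Q, 0 ≤ r Q) ∧
      G.pathOp A F ∘ₗ enc W ∘ₗ G.gInv = ∑ Q, (r Q : ℂ) • (pauliConj Q ∘ₗ enc W) := by
  choose p hp0 hp using hP F hF
  exact ⟨fun Q => ∑ s ∈ A, p s Q, fun Q => Finset.sum_nonneg fun s _ => hp0 s Q, sum_syndromes hp⟩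

theorem comp_gInv_injective {T T' : Super k n} (h : T ∘ₗ G.gInv = T') : T = T' ∘ₗ G.g := by
  rw [← h, LinearMap.comp_assoc, gInv_comp_g, LinearMap.comp_id]

theorem Implements.correctable_zero (hG : G.Implements W) : G.Correctable W 0 := by
  intro ρ
  rw [pauliConj_zero]
  exact hG.1 ρ

theorem Implements.exists_ideal_enc (hG : G.Implements W) (hW : Wᴴ * W = 1) (A : Finset S) :
    ∃ q : ℝ, G.ideal A ∘ₗ enc W = (q : ℂ) • (enc W ∘ₗ G.g) := by
  simpa [pauliConj_zero] using hG.correctable_zero.exists_ideal hG hW A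

/-- Errors of weight at most `t` are correctable. -/
theorem IsFaultTolerant.correctable (hFT : G.IsFaultTolerant W t) (hW : Wᴴ * W = 1)
    {P : Pauli n} (h : weight P ≤ t) : G.Correctable W P := by
  obtain ⟨r, -, hr, h1⟩ := hFT.exists_coeff Finset.univ (E := P) G.isFaultPath_zero
    (by rwa [numFaults_zero])
  rw [numFaults_zero] at hr
  have h2 : ∑ Q, (r Q : ℂ) • (pauliConj Q ∘ₗ enc W) = (r 0 : ℂ) • enc W := by
    rw [Finset.sum_eq_single 0]
    · rw [pauliConj_zero, LinearMap.id_comp]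
    · intro Q _ hQ
      rw [hr Q (Nat.pos_of_ne_zero fun h => hQ (weight_eq_zero.1 h)), Complex.ofReal_zero,
        zero_smul]
    · simp
  rw [h2, pathOp_zero] at h1
  -- Without faults only the identity survives in the output; trace preservation of the whole ideal
  -- gate fixes its coefficient.
  have h3 : (r 0 : ℂ) = 1 := by
    have hc : (Fintype.card (Bits k) : ℂ) ≠ 0 := Nat.cast_ne_zero.mpr Fintype.card_ne_zero
    have tr : ∀ Q : Pauli n, ((pauliConj Q ∘ₗ enc W) (1 : Op (Bits k))).trace =
        (Fintype.card (Bits k) : ℂ) := by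
      intro Q
      have := prob_pauliConj_comp_enc hW Q
      rwa [prob, div_eq_one_iff_eq hc] at this
    have tr0 := tr 0
    rw [pauliConj_zero, LinearMap.id_comp] at tr0
    have gi : G.gInv (1 : Op (Bits k)) = 1 := by
      rw [gInv, conjBy_apply, Matrix.mul_one, Matrix.conjTranspose_conjTranspose,
        ← Matrix.star_eq_conjTranspose, Unitary.star_mul_self_of_mem G.logical.2]
    have h4 := congrArg Matrix.trace (LinearMap.congr_fun h1 (1 : Op (Bits k)))
    rw [LinearMap.comp_apply, G.ideal_univ_isTP, LinearMap.comp_apply, gi, tr,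
      LinearMap.smul_apply, Matrix.trace_smul, tr0, smul_eq_mul] at h4
    exact (mul_right_cancel₀ hc ((one_mul _).trans h4)).symm
  rw [h3, one_smul, ← LinearMap.comp_assoc] at h1
  intro ρ
  exact LinearMap.congr_fun (comp_gInv_injective h1) ρ

theorem enc_comp_g_ne_zero (hW : Wᴴ * W = 1) : enc W ∘ₗ G.g ≠ 0 := by
  intro h
  have h1 : (LinearMap.id : Super k k) = 0 := by
    rw [← g_comp_gInv (G := G), ← LinearMap.id_comp G.g, ← dec_comp_enc hW, LinearMap.comp_assoc,
      LinearMap.comp_assoc, ← LinearMap.comp_assoc G.gInv G.g (enc W), h]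
    simp
  exact one_ne_zero (LinearMap.congr_fun h1 (1 : Op (Bits k)))

theorem Implements.occurs_univ (hG : G.Implements W) (hW : Wᴴ * W = 1) :
    G.Occurs W Finset.univ := by
  have : G.ideal Finset.univ ∘ₗ enc W = enc W ∘ₗ G.g := LinearMap.ext hG.1
  rw [Occurs, this]
  exact enc_comp_g_ne_zero hW

end Gate

/-! ### Expansion of error channels in Pauli errors -/

section Expands

variable {n k t : ℕ} {W : Matrix (Bits n) (Bits k) ℂ}

/-- Up to order `t`, `X` is a combination of Pauli errors on code states, in which an error of
weight `w` has a coefficient of order `w`. -/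
def Expands (W : Matrix (Bits n) (Bits k) ℂ) (t : ℕ) (a : Pauli n → ℝ → ℂ) (X : ℝ → Super k n) :
    Prop :=
  (∀ Q, IsOrd (min (weight Q) (t + 1)) (a Q)) ∧
    IsOrd (t + 1) fun ε => X ε - ∑ Q, a Q ε • (pauliConj Q ∘ₗ enc W)

variable {a b : Pauli n → ℝ → ℂ} {X Y : ℝ → Super k n}

theorem Expands.of_sub (h : Expands W t a X) (hXY : IsOrd (t + 1) fun ε => Y ε - X ε) :
    Expands W t a Y := by
  refine ⟨h.1, (hXY.add h.2).congr (Eventually.of_forall fun ε => ?_)⟩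
  abel

theorem Expands.smul {z : ℝ → ℂ} (hz : IsOrd 0 z) (h : Expands W t a X) :
    Expands W t (fun Q ε => z ε * a Q ε) fun ε => z ε • X ε := by
  refine ⟨fun Q => by simpa using hz.mul (h.1 Q), ?_⟩
  have h1 := hz.smul h.2
  rw [zero_add] at h1
  refine h1.congr (Eventually.of_forall fun ε => ?_)
  simp only [mul_smul, ← Finset.smul_sum]
  module

theorem Expands.sub_enc (h : Expands W t a X) : IsOrd 1 fun ε => X ε - a 0 ε • enc W := by
  have h1 : IsOrd 1 fun ε => ∑ Q ∈ Finset.univ.erase 0, a Q ε • (pauliConj Q ∘ₗ enc W) := by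
    refine IsOrd.sum fun Q hQ => ((h.1 Q).mono ?_).smul_const _
    have : weight Q ≠ 0 := fun h0 => Finset.ne_of_mem_erase hQ (weight_eq_zero.1 h0)
    omega
  refine ((h.2.mono (by omega)).add h1).congr (Eventually.of_forall fun ε => ?_)
  rw [← Finset.add_sum_erase _ _ (Finset.mem_univ (0 : Pauli n)), pauliConj_zero,
    LinearMap.id_comp]
  abel

theorem Expands.sub_enc_of_sub_one (h : Expands W t a X) (h1 : IsOrd 1 fun ε => a 0 ε - 1) :
    IsOrd 1 fun ε => X ε - enc W := by
  refine (h.sub_enc.add (h1.smul_const (enc W))).congr (Eventually.of_forall fun ε => ?_)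
  module

theorem prob_enc (hW : Wᴴ * W = 1) : prob (enc W) = 1 := by
  simpa [pauliConj_zero] using prob_pauliConj_comp_enc hW 0

/-- The coefficients need not be unique, but `prob` pins down that of the identity to first order.
-/
theorem Expands.coeff_zero (h : Expands W t a X) (hW : Wᴴ * W = 1) {q : ℂ}
    (hX : IsOrd 1 fun ε => X ε - q • enc W) : IsOrd 1 fun ε => a 0 ε - q := by
  refine ((hX.sub h.sub_enc).map (probLin k n)).congr (Eventually.of_forall fun ε => ?_)
  have : X ε - q • enc W - (X ε - a 0 ε • enc W) = (a 0 ε - q) • enc W := by module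
  rw [this, probLin_apply, prob_smul, prob_enc hW, mul_one]

theorem expands_enc (W : Matrix (Bits n) (Bits k) ℂ) (t : ℕ) :
    Expands W t (fun Q _ => if Q = 0 then 1 else 0) fun _ => enc W := by
  refine ⟨fun Q => ?_, ?_⟩
  · by_cases hQ : Q = 0
    · simpa [hQ, weight_zero] using IsOrd.const (1 : ℂ)
    · simpa [hQ] using IsOrd.zero (M := ℂ)
  · refine IsOrd.zero.congr (Eventually.of_forall fun ε => ?_)
    simp [pauliConj_zero]

end Expands

/-! ### Propagation of Pauli expansions through a noisy gate -/

section Output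

variable {n k t : ℕ} {S : Type*} [Fintype S] {G : Gate n k S} {W : Matrix (Bits n) (Bits k) ℂ}
  {A : Finset S}

/-- Linear action on the input channel, with the logical gate undone before. -/
def sandwich {m : ℕ} (T : Super n m) (R : Super k k) : Super k n →ₗ[ℂ] Super k m where
  toFun X := T ∘ₗ X ∘ₗ R
  map_add' X Y := by rw [LinearMap.add_comp, LinearMap.comp_add]
  map_smul' c X := by rw [LinearMap.smul_comp, LinearMap.comp_smul]; rfl

@[simp] theorem sandwich_apply {m : ℕ} (T : Super n m) (R : Super k k) (X : Super k n) :
    sandwich T R X = T ∘ₗ X ∘ₗ R := rfl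

theorem noisy_comp (ε : ℝ) (X : Super k n) :
    G.noisy ε A ∘ₗ X ∘ₗ G.gInv =
      ∑ F, (G.pathProb ε F : ℂ) • sandwich (G.pathOp A F) G.gInv X := by
  rw [G.noisy_eq_sum]
  ext1 ρ
  simp [LinearMap.sum_apply]

theorem Gate.noisy_isOrd {q : ℝ}
    (hq : G.ideal A ∘ₗ enc W = (q : ℂ) • (enc W ∘ₗ G.g)) {X : ℝ → Super k n}
    (hX : IsOrd 1 fun ε => X ε - enc W) :
    IsOrd 1 fun ε => G.noisy ε A ∘ₗ X ε ∘ₗ G.gInv - (q : ℂ) • enc W := by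
  classical
  have hX0 : IsOrd 0 X := hX.of_sub_const
  have h0 : sandwich (G.ideal A) G.gInv (enc W) = (q : ℂ) • enc W := by
    rw [sandwich_apply, ← LinearMap.comp_assoc, hq, LinearMap.smul_comp, LinearMap.comp_assoc,
      g_comp_gInv, LinearMap.comp_id]
  have h1 : IsOrd 1 fun ε => ∑ F ∈ Finset.univ.erase 0,
      (G.pathProb ε F : ℂ) • sandwich (G.pathOp A F) G.gInv (X ε) :=
    IsOrd.sum fun F hF => ((G.pathProb_isOrd F).mono
      (G.numFaults_pos (Finset.ne_of_mem_erase hF))).smul (hX0.map _)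
  have h2 := G.pathProb_zero_isOrd.smul (hX0.map (sandwich (G.ideal A) G.gInv))
  have h3 := hX.map (sandwich (G.ideal A) G.gInv)
  refine ((h1.add h2).add h3).congr (Eventually.of_forall fun ε => ?_)
  rw [noisy_comp, ← Finset.add_sum_erase _ _ (Finset.mem_univ 0), G.pathOp_zero, map_sub, h0]
  module

/-- The coefficients of the output error of a gate: to leading order they depend only on the
gate. -/
theorem Gate.IsFaultTolerant.expands_noisy (hFT : G.IsFaultTolerant W t) (A : Finset S) :
    ∃ c : Pauli n → ℝ → ℂ, (∀ Q, IsOrd (min (weight Q) (t + 1)) (c Q)) ∧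
      ∀ a X, Expands W t a X → ∃ b,
        Expands W t b (fun ε => G.noisy ε A ∘ₗ X ε ∘ₗ G.gInv) ∧
        ∀ Q, IsOrd (min (weight Q + 1) (t + 1)) fun ε => b Q ε - a 0 ε * c Q ε := by
  classical
  -- Fault tolerance applies exactly to these pairs. For all other pairs `r` is set to `0`, and the
  -- neglected term goes into the remainder.
  let small (E : Pauli n) (F : Fin G.locs → Pauli G.reg) : Prop :=
    G.IsFaultPath F ∧ weight E + G.numFaults F ≤ t
  have hex : ∀ E F, ∃ r : Pauli n → ℝ,
      (∀ Q, r Q ≠ 0 → weight Q ≤ G.numFaults F) ∧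
      (small E F → G.pathOp A F ∘ₗ (pauliConj E ∘ₗ enc W) ∘ₗ G.gInv =
        ∑ Q, (r Q : ℂ) • (pauliConj Q ∘ₗ enc W)) := by
    intro E F
    by_cases h : small E F
    · obtain ⟨r, -, hr, h1⟩ := hFT.exists_coeff A h.1 h.2
      exact ⟨r, fun Q hQ => not_lt.1 fun h2 => hQ (hr Q h2), fun _ => h1⟩
    · exact ⟨0, fun Q hQ => absurd rfl hQ, fun h1 => absurd h1 h⟩
  choose r hrw hr using hex
  -- A nonzero `r E F Q` forces at least `weight Q` faults, so the path probability supplies that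
  -- many powers of `ε`.
  have hord : ∀ {m : ℕ} {x : ℝ → ℂ} (E : Pauli n) (F : Fin G.locs → Pauli G.reg) (Q : Pauli n)
      {l : ℕ}, IsOrd m x → (weight Q ≤ G.numFaults F → l ≤ m + G.numFaults F) →
      IsOrd l fun ε => x ε * G.pathProb ε F * r E F Q := by
    intro m x E F Q l hx hl
    by_cases h0 : r E F Q = 0
    · simpa [h0] using IsOrd.zero (M := ℂ)
    · exact (((hx.mul (G.pathProb_isOrd F)).mul (IsOrd.const (r E F Q : ℂ)))).mono
        (hl (hrw E F Q h0))
  -- The universal coefficients are those produced by an error-free input.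
  refine ⟨fun Q ε => ∑ F, (G.pathProb ε F : ℂ) * r 0 F Q, fun Q => IsOrd.sum fun F _ => ?_, ?_⟩
  · simpa using hord (l := min (weight Q) (t + 1)) 0 F Q (IsOrd.const (1 : ℂ)) (by omega)
  intro a X hX
  refine ⟨fun Q ε => ∑ E, ∑ F, a E ε * G.pathProb ε F * r E F Q,
    ⟨fun Q => IsOrd.sum fun E _ => IsOrd.sum fun F _ => hord E F Q (hX.1 E) (by omega), ?_⟩,
    fun Q => ?_⟩
  · have h1 : IsOrd (t + 1) fun ε => ∑ F, (G.pathProb ε F : ℂ) • sandwich (G.pathOp A F) G.gInv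
        (X ε - ∑ Q, a Q ε • (pauliConj Q ∘ₗ enc W)) :=
      IsOrd.sum fun F _ => ((G.pathProb_isOrd F).smul (hX.2.map _)).mono (by omega)
    have h2 : IsOrd (t + 1) fun ε => ∑ E, ∑ F, (a E ε * G.pathProb ε F) •
        (sandwich (G.pathOp A F) G.gInv (pauliConj E ∘ₗ enc W) -
          ∑ Q, (r E F Q : ℂ) • (pauliConj Q ∘ₗ enc W)) := by
      refine IsOrd.sum fun E _ => IsOrd.sum fun F _ => ?_
      by_cases hs : small E F
      · rw [sandwich_apply, hr E F hs, sub_self]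
        simpa using IsOrd.zero
      · by_cases hF : G.IsFaultPath F
        · refine (((hX.1 E).mul (G.pathProb_isOrd F)).smul_const _).mono ?_
          have : ¬ weight E + G.numFaults F ≤ t := fun h => hs ⟨hF, h⟩
          omega
        · simpa [G.pathProb_eq_zero hF] using IsOrd.zero
    refine (h1.add h2).congr (Eventually.of_forall fun ε => ?_)
    beta_reduce
    rw [noisy_comp]
    simp only [map_sub, map_sum, map_smul, smul_sub, Finset.sum_sub_distrib, Finset.smul_sum,
      Finset.sum_smul, smul_smul]
    have e1 : ∑ F, ∑ E, ((G.pathProb ε F : ℂ) * a E ε) •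
        sandwich (G.pathOp A F) G.gInv (pauliConj E ∘ₗ enc W) =
        ∑ E, ∑ F, (a E ε * G.pathProb ε F) •
          sandwich (G.pathOp A F) G.gInv (pauliConj E ∘ₗ enc W) := by
      rw [Finset.sum_comm]
      simp only [mul_comm]
    have e2 : ∑ E, ∑ F, ∑ Q, (a E ε * G.pathProb ε F * r E F Q) • (pauliConj Q ∘ₗ enc W) =
        ∑ Q, ∑ E, ∑ F, (a E ε * G.pathProb ε F * r E F Q) • (pauliConj Q ∘ₗ enc W) := by
      rw [Finset.sum_comm' (t' := Finset.univ) (s' := fun _ => Finset.univ) (by simp)]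
      refine (Finset.sum_congr rfl fun F _ => Finset.sum_comm).trans ?_
      rw [Finset.sum_comm]
      exact Finset.sum_congr rfl fun Q _ => Finset.sum_comm
    rw [e1, e2]
    abel
  -- Nontrivial input errors carry at least one additional factor `ε`.
  · have h1 : IsOrd (min (weight Q + 1) (t + 1)) fun ε =>
        ∑ E ∈ Finset.univ.erase 0, ∑ F, a E ε * G.pathProb ε F * r E F Q := by
      refine IsOrd.sum fun E hE => IsOrd.sum fun F _ => hord E F Q (hX.1 E) ?_
      have : weight E ≠ 0 := fun h0 => Finset.ne_of_mem_erase hE (weight_eq_zero.1 h0)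
      omega
    refine h1.congr (Eventually.of_forall fun ε => ?_)
    simp only
    rw [← Finset.add_sum_erase Finset.univ
      (fun E => ∑ F, a E ε * G.pathProb ε F * r E F Q) (Finset.mem_univ 0), Finset.mul_sum]
    simp only [mul_assoc]
    ring

theorem Gate.Implements.exists_ideal_enc_ne_zero (hG : G.Implements W) (hW : Wᴴ * W = 1)
    (hA : G.Occurs W A) :
    ∃ q : ℝ, (q : ℂ) ≠ 0 ∧ G.ideal A ∘ₗ enc W = (q : ℂ) • (enc W ∘ₗ G.g) := by
  obtain ⟨q, hq⟩ := hG.exists_ideal_enc hW A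
  refine ⟨q, fun h0 => hA ?_, hq⟩
  rw [hq, h0, zero_smul]

theorem Gate.prob_noisy (hW : Wᴴ * W = 1) {q : ℝ}
    (hq : G.ideal A ∘ₗ enc W = (q : ℂ) • (enc W ∘ₗ G.g)) {X : ℝ → Super k n}
    (hX : IsOrd 1 fun ε => X ε - enc W) :
    IsOrd 1 fun ε => prob (G.noisy ε A ∘ₗ X ε ∘ₗ G.gInv) - q := by
  refine ((Gate.noisy_isOrd hq hX).map (probLin k n)).congr (Eventually.of_forall fun ε => ?_)
  rw [map_sub, map_smul, probLin_apply, probLin_apply, prob_enc hW, smul_eq_mul, mul_one]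

/-- The normalizing factor tends to `q⁻¹` and the identity coefficient of the input to `1`, so after
normalization too the leading coefficients do not depend on the input. -/
theorem Gate.IsFaultTolerant.expands_outputError (hFT : G.IsFaultTolerant W t)
    (hG : G.Implements W) (hW : Wᴴ * W = 1) (hA : G.Occurs W A) :
    ∃ c : Pauli n → ℝ → ℂ, ∀ a X, Expands W t a X → IsOrd 1 (fun ε => a 0 ε - 1) → ∃ b,
      Expands W t b (fun ε => outputError G ε A (X ε)) ∧
      (∀ Q, IsOrd (min (weight Q + 1) (t + 1)) fun ε => b Q ε - c Q ε) ∧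
      IsOrd 1 fun ε => b 0 ε - 1 := by
  obtain ⟨q, hq0, hq⟩ := hG.exists_ideal_enc_ne_zero hW hA
  obtain ⟨c, hc, h⟩ := hFT.expands_noisy A
  refine ⟨fun Q ε => (q : ℂ)⁻¹ * c Q ε, fun a X hX ha => ?_⟩
  obtain ⟨b, hb, hbc⟩ := h a X hX
  have hXe := hX.sub_enc_of_sub_one ha
  have hz := (Gate.prob_noisy hW hq hXe).inv hq0
  have hz0 := hz.of_sub_const
  have hb0 := hb.coeff_zero hW (Gate.noisy_isOrd hq hXe)
  have hqc : IsOrd 0 fun _ : ℝ => (q : ℂ)⁻¹ := IsOrd.const _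
  refine ⟨_, hb.smul hz0, fun Q => ?_, ?_⟩
  · have h1 := hz0.mul (hbc Q)
    -- With normalizing factor `z`, this is `z a₀ - q⁻¹ = (z - q⁻¹) a₀ + q⁻¹ (a₀ - 1)`, of order
    -- `1`.
    have h2 := ((hz.mul ha.of_sub_const).add (hqc.mul ha)).mul (hc Q)
    rw [zero_add] at h1
    refine (h1.add (h2.mono (by omega))).congr (Eventually.of_forall fun ε => ?_)
    ring
  · refine ((hz.mul hb0.of_sub_const).add (hqc.mul hb0)).congr (Eventually.of_forall fun ε => ?_)
    field_simp
    ring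

end Output

/-! ### Logical errors -/

theorem logical_sub_smul {k : ℕ} (c d : ℂ) (T : Super k k) : (c - d) • T = c • T - d • T := by
  module

section Logical

variable {n k t : ℕ} {S : Type*} [Fintype S] {G : Gate n k S} {W : Matrix (Bits n) (Bits k) ℂ}
  {A : Finset S}

/-- The unnormalized logical error, as a linear map. -/
def decodeLin (W : Matrix (Bits n) (Bits k) ℂ) (G : Gate n k S) (A : Finset S) :
    Super k n →ₗ[ℂ] Super k k :=
  sandwich (G.gInv ∘ₗ dec W ∘ₗ G.ideal A) LinearMap.id

theorem decodeLin_apply (X : Super k n) :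
    decodeLin W G A X = G.gInv ∘ₗ dec W ∘ₗ G.ideal A ∘ₗ X := rfl

theorem logicalError_eq (X : Super k n) :
    logicalError W G A X = normalize (decodeLin W G A X) := rfl

theorem decodeLin_of_ideal (hW : Wᴴ * W = 1) {X : Super k n} {q : ℂ}
    (h : G.ideal A ∘ₗ X = q • (enc W ∘ₗ G.g)) : decodeLin W G A X = q • LinearMap.id := by
  rw [decodeLin_apply, h, LinearMap.comp_smul, LinearMap.comp_smul,
    ← LinearMap.comp_assoc G.g (enc W) (dec W), dec_comp_enc hW, LinearMap.id_comp, gInv_comp_g]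

theorem Gate.Correctable.exists_decodeLin {P : Pauli n} (h : G.Correctable W P)
    (hG : G.Implements W) (hW : Wᴴ * W = 1) (A : Finset S) :
    ∃ q : ℂ, decodeLin W G A (pauliConj P ∘ₗ enc W) = q • LinearMap.id := by
  obtain ⟨q, hq⟩ := h.exists_ideal hG hW A
  exact ⟨q, decodeLin_of_ideal hW hq⟩

/-- Errors of weight at most `t` decode to scalars; heavier ones have coefficients of order `t + 1`.
-/
theorem Gate.Implements.decodeLin_sub (hG : G.Implements W) (hW : Wᴴ * W = 1)
    (hc : ∀ P, weight P ≤ t → G.Correctable W P) (hA : G.Occurs W A)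
    {b : Pauli n → ℝ → ℂ} {X : ℝ → Super k n} (hX : Expands W t b X)
    (hb : IsOrd 1 fun ε => b 0 ε - 1) :
    ∃ (σ : ℝ → ℂ) (q : ℂ), q ≠ 0 ∧ IsOrd 1 (fun ε => σ ε - q) ∧
      IsOrd (t + 1) fun ε => decodeLin W G A (X ε) - σ ε • LinearMap.id := by
  classical
  obtain ⟨q, hq0, hq⟩ := hG.exists_ideal_enc_ne_zero hW hA
  have hd := decodeLin_of_ideal hW hq
  have hex : ∀ P : Pauli n, ∃ u : ℂ, weight P ≤ t →
      decodeLin W G A (pauliConj P ∘ₗ enc W) = u • LinearMap.id := by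
    intro P
    by_cases h : weight P ≤ t
    · obtain ⟨u, hu⟩ := (hc P h).exists_decodeLin hG hW A
      exact ⟨u, fun _ => hu⟩
    · exact ⟨0, fun h' => absurd h' h⟩
  choose u hu using hex
  have h1 : IsOrd (t + 1) fun ε => decodeLin W G A (X ε) - (∑ P, b P ε * u P) • LinearMap.id := by
    have h2 : IsOrd (t + 1) fun ε => ∑ P, b P ε •
        (decodeLin W G A (pauliConj P ∘ₗ enc W) - u P • LinearMap.id) := by
      refine IsOrd.sum fun P _ => ?_
      by_cases h : weight P ≤ t
      · simpa [hu P h] using IsOrd.zero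
      · exact ((hX.1 P).mono (by omega)).smul_const _
    refine ((hX.2.map (decodeLin W G A)).add h2).congr (Eventually.of_forall fun ε => ?_)
    simp only [map_sub, map_sum, map_smul, smul_sub, Finset.sum_sub_distrib, Finset.sum_smul,
      smul_smul]
    abel
  refine ⟨_, q, hq0, ?_, h1⟩
  have h3 := (hX.sub_enc_of_sub_one hb).map (decodeLin W G A)
  refine ((h3.sub (h1.mono (by omega))).map (probLin k k)).congr
    (Eventually.of_forall fun ε => ?_)
  have e : decodeLin W G A (X ε - enc W) -
      (decodeLin W G A (X ε) - (∑ P, b P ε * u P) • LinearMap.id) =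
      ((∑ P, b P ε * u P) - q) • LinearMap.id := by
    rw [(decodeLin W G A).map_sub, hd]
    module
  rw [e, probLin_apply, prob_smul, prob_id, mul_one]

theorem Gate.Implements.logicalError_sub_id (hG : G.Implements W) (hW : Wᴴ * W = 1)
    (hc : ∀ P, weight P ≤ t → G.Correctable W P) (hA : G.Occurs W A)
    {b : Pauli n → ℝ → ℂ} {X : ℝ → Super k n} (hX : Expands W t b X)
    (hb : IsOrd 1 fun ε => b 0 ε - 1) :
    IsOrd (t + 1) fun ε => logicalError W G A (X ε) - LinearMap.id := by
  obtain ⟨σ, q, hq, hσ, h⟩ := hG.decodeLin_sub hW hc hA hX hb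
  exact (normalize_sub_id (by omega) hq h hσ).2

/-- Composition with the inverse of the logical error does not change the expansion. -/
theorem expands_comp_inverse {b : Pauli n → ℝ → ℂ} {X : ℝ → Super k n}
    {Λ : ℝ → Module.End ℂ (Op (Bits k))} (hX : Expands W t b X)
    (hb : IsOrd 1 fun ε => b 0 ε - 1) (hΛ : IsOrd (t + 1) fun ε => Λ ε - 1) :
    (∀ᶠ ε in 𝓝[>] (0 : ℝ), IsUnit (Λ ε)) ∧
      Expands W t b fun ε => X ε ∘ₗ Ring.inverse (Λ ε) := by
  obtain ⟨h1, h2⟩ := hΛ.ringInverse (by omega)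
  -- The change is `X ∘ (Λ⁻¹ - 1)`, a bounded factor times one of order `t + 1`.
  refine ⟨h1, hX.of_sub ?_⟩
  have h3 : IsOrd 0 X := (hX.sub_enc_of_sub_one hb).of_sub_const
  have h4 := IsOrd.bilin (LinearMap.llcomp ℂ (Op (Bits k)) (Op (Bits k)) (Op (Bits n))) h3 h2
  rw [zero_add] at h4
  refine h4.congr (Eventually.of_forall fun ε => ?_)
  ext1 ρ
  simp [LinearMap.llcomp_apply]

/-- An input channel whose error is corrected by the ideal gate up to a factor. -/
theorem Gate.Implements.ideal_comp (hG : G.Implements W) (hW : Wᴴ * W = 1) {X : Super k n} {s : ℂ}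
    (h : decodeLin W G A X = s • LinearMap.id) : G.ideal A ∘ₗ X ∘ₗ G.gInv = s • enc W := by
  have h1 : dec W ∘ₗ G.ideal A ∘ₗ X = s • G.g := by
    calc dec W ∘ₗ G.ideal A ∘ₗ X = (G.g ∘ₗ G.gInv) ∘ₗ dec W ∘ₗ G.ideal A ∘ₗ X := by
          rw [g_comp_gInv, LinearMap.id_comp]
      _ = G.g ∘ₗ decodeLin W G A X := by rw [LinearMap.comp_assoc, decodeLin_apply]
      _ = s • G.g := by rw [h, LinearMap.comp_smul, LinearMap.comp_id]
  calc G.ideal A ∘ₗ X ∘ₗ G.gInv = enc W ∘ₗ (dec W ∘ₗ G.ideal A ∘ₗ X) ∘ₗ G.gInv := by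
        conv_lhs => rw [← hG.enc_dec_ideal hW A]
        rfl
    _ = s • enc W := by
        rw [h1, LinearMap.smul_comp, g_comp_gInv, LinearMap.comp_smul, LinearMap.comp_id]

/-- Decoding `Y` gives a multiple of its logical error, which the inverse cancels. This is an exact
identity at each `ε`, and it makes the fault-free path harmless for the exact input. -/
theorem decodeLin_comp_inverse {Y : Super k n} (h : IsUnit (M := Module.End ℂ (Op (Bits k)))
    (logicalError W G A Y)) :
    decodeLin W G A (Y ∘ₗ Ring.inverse (M₀ := Module.End ℂ (Op (Bits k)))
      (logicalError W G A Y)) = prob (decodeLin W G A Y) • LinearMap.id := by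
  set M := decodeLin W G A Y with hM
  have h0 : prob M ≠ 0 := by
    -- By the convention `0⁻¹ = 0`, a vanishing `prob` would make the logical error zero, which is
    -- not a unit.
    intro h0
    rw [logicalError_eq, ← hM, normalize, h0, inv_zero, zero_smul] at h
    exact not_isUnit_zero h
  have h1 : M = prob M • logicalError W G A Y := by
    rw [logicalError_eq, ← hM, normalize, smul_smul, mul_inv_cancel₀ h0, one_smul]
  have h2 : decodeLin W G A (Y ∘ₗ Ring.inverse (M₀ := Module.End ℂ (Op (Bits k)))
      (logicalError W G A Y)) = M ∘ₗ Ring.inverse (M₀ := Module.End ℂ (Op (Bits k)))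
      (logicalError W G A Y) := rfl
  rw [h2]
  conv_lhs => rw [h1]
  rw [LinearMap.smul_comp]
  congr 1
  exact Ring.mul_inverse_cancel (M₀ := Module.End ℂ (Op (Bits k))) _ h

end Logical

/-! ### Comparison of two input channels -/

section Compare

variable {n k t : ℕ} {S : Type*} [Fintype S] {G G' : Gate n k S} {W : Matrix (Bits n) (Bits k) ℂ}
  {A A' : Finset S}

/-- The logical error for the fault-path `F`, as a linear map of the input error. -/
def pathLogical (W : Matrix (Bits n) (Bits k) ℂ) (G G' : Gate n k S) (A A' : Finset S)
    (F : Fin G.locs → Pauli G.reg) : Super k n →ₗ[ℂ] Super k k :=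
  decodeLin W G' A' ∘ₗ sandwich (G.pathOp A F) G.gInv

theorem decodeLin_noisy (ε : ℝ) (X : Super k n) :
    decodeLin W G' A' (G.noisy ε A ∘ₗ X ∘ₗ G.gInv) =
      ∑ F, (G.pathProb ε F : ℂ) • pathLogical W G G' A A' F X := by
  rw [noisy_comp, map_sum]
  simp only [map_smul]
  rfl

/-- The output error has weight at most the number of faults, hence at most `t`, and the next ideal
gate corrects it. -/
theorem Gate.IsFaultTolerant.exists_pathLogical (hFT : G.IsFaultTolerant W t)
    (hW : Wᴴ * W = 1) (hG' : G'.Implements W) (hc : ∀ P, weight P ≤ t → G'.Correctable W P)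
    (A A' : Finset S) :
    ∃ u : Pauli n → (Fin G.locs → Pauli G.reg) → ℂ, ∀ E F, G.IsFaultPath F →
      weight E + G.numFaults F ≤ t →
        pathLogical W G G' A A' F (pauliConj E ∘ₗ enc W) = u E F • LinearMap.id := by
  suffices h : ∀ E F, ∃ u : ℂ, G.IsFaultPath F → weight E + G.numFaults F ≤ t →
      pathLogical W G G' A A' F (pauliConj E ∘ₗ enc W) = u • LinearMap.id by
    choose u hu using h
    exact ⟨u, hu⟩
  intro E F
  by_cases h : G.IsFaultPath F ∧ weight E + G.numFaults F ≤ t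
  swap
  · exact ⟨0, fun h1 h2 => absurd ⟨h1, h2⟩ h⟩
  obtain ⟨r, -, hr, h1⟩ := hFT.exists_coeff A h.1 h.2
  have hex : ∀ Q : Pauli n, ∃ v : ℂ,
      decodeLin W G' A' ((r Q : ℂ) • (pauliConj Q ∘ₗ enc W)) = v • LinearMap.id := by
    intro Q
    by_cases hQ : weight Q ≤ t
    · obtain ⟨v, hv⟩ := (hc Q hQ).exists_decodeLin hG' hW A'
      exact ⟨r Q * v, by rw [map_smul, hv, smul_smul]⟩
    · refine ⟨0, ?_⟩
      rw [hr Q (by omega), Complex.ofReal_zero, zero_smul, map_zero, zero_smul]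
  choose v hv using hex
  refine ⟨∑ Q, v Q, fun _ _ => ?_⟩
  rw [pathLogical, LinearMap.comp_apply, sandwich_apply, h1, map_sum, Finset.sum_smul]
  exact Finset.sum_congr rfl fun Q _ => hv Q

/-- The hypotheses `hs` and `hs'` make the fault-free path an exact scalar for both inputs. On all
other paths at least one fault improves the agreement of the inputs by a factor `ε`. -/
theorem logicalError_outputError_sub (hW : Wᴴ * W = 1) (hFT : G.IsFaultTolerant W t)
    (hG : G.Implements W) (hA : G.Occurs W A)
    (hG' : G'.Implements W) (hc : ∀ P, weight P ≤ t → G'.Correctable W P) (hA' : G'.Occurs W A')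
    {a a' : Pauli n → ℝ → ℂ} {X X' : ℝ → Super k n} {s s' : ℝ → ℂ}
    (hX : Expands W t a X) (hX' : Expands W t a' X')
    (ha : IsOrd 1 fun ε => a 0 ε - 1) (ha' : IsOrd 1 fun ε => a' 0 ε - 1)
    (haa : ∀ Q, IsOrd (min (weight Q + 1) (t + 1)) fun ε => a Q ε - a' Q ε)
    (hs : ∀ᶠ ε in 𝓝[>] (0 : ℝ), decodeLin W G A (X ε) = s ε • LinearMap.id)
    (hs' : ∀ᶠ ε in 𝓝[>] (0 : ℝ), decodeLin W G A (X' ε) = s' ε • LinearMap.id) :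
    IsOrd (t + 2) fun ε => logicalError W G' A' (outputError G ε A (X ε)) -
      logicalError W G' A' (outputError G ε A (X' ε)) := by
  classical
  obtain ⟨q, hq0, hq⟩ := hG.exists_ideal_enc_ne_zero hW hA
  obtain ⟨q', hq0', hq'⟩ := hG'.exists_ideal_enc_ne_zero hW hA'
  obtain ⟨u, hu⟩ := hFT.exists_pathLogical hW hG' hc A A'
  let U := pathLogical W G G' A A'
  let V (E : Pauli n) (F : Fin G.locs → Pauli G.reg) : Super k k :=
    U F (pauliConj E ∘ₗ enc W) - u E F • LinearMap.id
  -- The scalar part: the whole fault-free path, plus the scalars `u E F` of the remaining paths.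
  -- For pairs outside the range of fault tolerance `u E F` is arbitrary, and `V E F` compensates.
  let σ (a : Pauli n → ℝ → ℂ) (s : ℝ → ℂ) (ε : ℝ) : ℂ := G.pathProb ε 0 * s ε * q' +
    ∑ F ∈ Finset.univ.erase 0, ∑ E, G.pathProb ε F * a E ε * u E F
  let N (X : ℝ → Super k n) (ε : ℝ) := decodeLin W G' A' (G.noisy ε A ∘ₗ X ε ∘ₗ G.gInv)
  let res (a : Pauli n → ℝ → ℂ) (X : ℝ → Super k n) (ε : ℝ) : Super k n :=
    X ε - ∑ Q, a Q ε • (pauliConj Q ∘ₗ enc W)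
  have hF1 : ∀ F ∈ Finset.univ.erase (0 : Fin G.locs → Pauli G.reg), 1 ≤ G.numFaults F :=
    fun F hF => G.numFaults_pos (Finset.ne_of_mem_erase hF)
  have hN : ∀ (a : Pauli n → ℝ → ℂ) (X : ℝ → Super k n) (s : ℝ → ℂ) (ε : ℝ),
      decodeLin W G A (X ε) = s ε • LinearMap.id →
      N X ε - σ a s ε • LinearMap.id = ∑ F ∈ Finset.univ.erase 0,
        ((G.pathProb ε F : ℂ) • U F (res a X ε) + ∑ E, ((G.pathProb ε F : ℂ) * a E ε) • V E F) := by
    intro a X s ε h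
    have h0 : U 0 (X ε) = (s ε * q') • LinearMap.id := by
      simp only [U, pathLogical, LinearMap.comp_apply, sandwich_apply]
      rw [G.pathOp_zero, hG.ideal_comp hW h, map_smul, decodeLin_of_ideal hW hq', smul_smul]
    simp only [N, σ, V, res]
    rw [decodeLin_noisy, ← Finset.add_sum_erase _ _ (Finset.mem_univ 0)]
    change _ • U 0 (X ε) + ∑ F ∈ Finset.univ.erase 0, _ • U F (X ε) - _ = _
    rw [h0]
    simp only [map_sub, map_sum, map_smul, smul_sub, Finset.smul_sum, smul_smul,
      Finset.sum_add_distrib, Finset.sum_sub_distrib, add_smul, Finset.sum_smul, mul_assoc]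
    abel
  have hVord : ∀ (F) (_ : F ∈ Finset.univ.erase (0 : Fin G.locs → Pauli G.reg)) (E : Pauli n)
      {x : ℝ → ℂ} {m l : ℕ}, IsOrd m x →
      (t < weight E + G.numFaults F → l ≤ G.numFaults F + m) →
      IsOrd l fun ε => ((G.pathProb ε F : ℂ) * x ε) • V E F := by
    intro F _ E x m l hx hl
    by_cases hF : G.IsFaultPath F
    · by_cases h : weight E + G.numFaults F ≤ t
      · have : V E F = 0 := sub_eq_zero.2 (hu E F hF h)
        simpa [this] using IsOrd.zero
      · exact (((G.pathProb_isOrd F).mul hx).smul_const _).mono (hl (not_le.1 h))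
    · simpa [G.pathProb_eq_zero hF] using IsOrd.zero
  have hres : ∀ {a X}, Expands W t a X → ∀ F ∈ Finset.univ.erase (0 : Fin G.locs → Pauli G.reg),
      IsOrd (t + 2) fun ε => (G.pathProb ε F : ℂ) • U F (res a X ε) := by
    intro a X h F hF
    have := hF1 F hF
    exact ((G.pathProb_isOrd F).smul (h.2.map (U F))).mono (by omega)
  have hNord : IsOrd (t + 1) fun ε => N X ε - σ a s ε • LinearMap.id := by
    have h1 : IsOrd (t + 1) fun ε => ∑ F ∈ Finset.univ.erase 0,
        ((G.pathProb ε F : ℂ) • U F (res a X ε) +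
          ∑ E, ((G.pathProb ε F : ℂ) * a E ε) • V E F) := by
      refine IsOrd.sum fun F hF => ((hres hX F hF).mono (by omega)).add
        (IsOrd.sum fun E _ => hVord F hF E (hX.1 E) ?_)
      have := hF1 F hF
      omega
    refine h1.congr ?_
    filter_upwards [hs] with ε hε
    rw [hN a X s ε hε]
  have hdiff : IsOrd (t + 1 + 1) fun ε =>
      (N X ε - N X' ε) - (σ a s ε - σ a' s' ε) • LinearMap.id := by
    have h1 : IsOrd (t + 1 + 1) fun ε => ∑ F ∈ Finset.univ.erase 0,
        ((G.pathProb ε F : ℂ) • U F (res a X ε) - (G.pathProb ε F : ℂ) • U F (res a' X' ε) +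
          ∑ E, ((G.pathProb ε F : ℂ) * (a E ε - a' E ε)) • V E F) := by
      -- With `w` the weight of `E` and `f ≥ 1` faults, `t < w + f` gives `t + 2 ≤ f + min (w + 1)
      -- (t + 1)`.
      refine IsOrd.sum fun F hF => ((hres hX F hF).sub (hres hX' F hF)).add
        (IsOrd.sum fun E _ => hVord F hF E (haa E) ?_)
      have := hF1 F hF
      omega
    refine h1.congr ?_
    filter_upwards [hs, hs'] with ε hε hε'
    have e1 : (N X ε - N X' ε) - (σ a s ε - σ a' s' ε) • LinearMap.id =
        (N X ε - σ a s ε • LinearMap.id) - (N X' ε - σ a' s' ε • LinearMap.id) := by module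
    rw [e1, hN a X s ε hε, hN a' X' s' ε hε', ← Finset.sum_sub_distrib]
    refine Finset.sum_congr rfl fun F _ => ?_
    simp only [mul_sub, logical_sub_smul, Finset.sum_sub_distrib]
    abel
  have hσ : ∀ {a X s}, Expands W t a X → IsOrd 1 (fun ε => a 0 ε - 1) →
      (∀ᶠ ε in 𝓝[>] (0 : ℝ), decodeLin W G A (X ε) = s ε • LinearMap.id) →
      IsOrd 1 fun ε => σ a s ε - q * q' := by
    intro a X s hX ha hs
    have h1 : IsOrd 1 fun ε => s ε - q := by
      refine (((hX.sub_enc_of_sub_one ha).map (decodeLin W G A)).map (probLin k k)).congr ?_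
      filter_upwards [hs] with ε hε
      rw [map_sub, hε, decodeLin_of_ideal hW hq, ← logical_sub_smul, probLin_apply, prob_smul, prob_id,
        mul_one]
    have h2 := (G.pathProb_zero_isOrd.mul h1.of_sub_const).mul (IsOrd.const (q' : ℂ))
    have h3 := h1.mul (IsOrd.const (q' : ℂ))
    have h4 : IsOrd 1 fun ε => ∑ F ∈ Finset.univ.erase 0, ∑ E,
        G.pathProb ε F * a E ε * u E F := by
      refine IsOrd.sum fun F hF => IsOrd.sum fun E _ => ?_
      have := hF1 F hF
      exact (((G.pathProb_isOrd F).mul (hX.1 E)).mul (IsOrd.const (u E F))).mono (by omega)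
    refine ((h2.add h3).add h4).congr (Eventually.of_forall fun ε => ?_)
    simp only [σ]
    ring
  have hmain := normalize_sub_normalize (by omega) (mul_ne_zero hq0 hq0') hNord
    (hσ hX ha hs) (hσ hX' ha' hs') hdiff
  have hout : ∀ {a X}, Expands W t a X → IsOrd 1 (fun ε => a 0 ε - 1) →
      ∀ᶠ ε in 𝓝[>] (0 : ℝ), logicalError W G' A' (outputError G ε A (X ε)) =
        normalize (N X ε) := by
    intro a X hX ha
    have h1 := Gate.prob_noisy hW hq (hX.sub_enc_of_sub_one ha)
    filter_upwards [h1.eventually_ne hq0] with ε hε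
    rw [logicalError_eq, outputError, normalize.eq_def (G.noisy ε A ∘ₗ X ε ∘ₗ G.gInv), map_smul,
      normalize_smul (inv_ne_zero hε)]
  refine hmain.congr ?_
  filter_upwards [hout hX ha, hout hX' ha'] with ε hε hε'
  rw [hε, hε']

end Compare

/-! ### The P2LC input channel -/

section Input

variable {n k t : ℕ} {S : Type*} [Fintype S] {G : Gate n k S} {W : Matrix (Bits n) (Bits k) ℂ}
  {A : Finset S}

/-- Paths with at most `t` faults are expanded by fault tolerance, which bounds the weights. The
others have order at least `t + 1`, and for them the bare Pauli error hypothesis suffices. -/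
theorem Gate.HasPauliErrors.exists_pauliChannel (hP : G.HasPauliErrors W)
    (hFT : G.IsFaultTolerant W t) (hG : G.Implements W) (hW : Wᴴ * W = 1) (hA : G.Occurs W A) :
    ∃ p : ℝ → Pauli n → ℝ, (∀ ε, 0 ≤ ε → ε ≤ 1 → (∀ P, 0 ≤ p ε P) ∧
      outputError G ε A (enc W) = pauliChannel W (p ε)) ∧
      ∀ P, t < weight P → IsOrd (t + 1) fun ε => (p ε P : ℂ) := by
  classical
  obtain ⟨q, hq0, hq⟩ := hG.exists_ideal_enc_ne_zero hW hA
  have hex : ∀ F, ∃ r : Pauli n → ℝ, (∀ Q, 0 ≤ r Q) ∧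
      (∀ Q, r Q ≠ 0 → G.numFaults F ≤ t → weight Q ≤ G.numFaults F) ∧
      (G.IsFaultPath F → G.pathOp A F ∘ₗ enc W ∘ₗ G.gInv =
        ∑ Q, (r Q : ℂ) • (pauliConj Q ∘ₗ enc W)) := by
    intro F
    by_cases hF : G.IsFaultPath F
    · by_cases ht : G.numFaults F ≤ t
      · obtain ⟨r, hr0, hr, h⟩ := hFT.exists_coeff A (E := 0) hF (by rwa [weight_zero, zero_add])
        rw [pauliConj_zero, LinearMap.id_comp] at h
        exact ⟨r, hr0, fun Q hQ _ => not_lt.1 fun h2 => hQ (hr Q h2), fun _ => h⟩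
      · obtain ⟨r, hr0, h⟩ := hP.exists_coeff A hF
        exact ⟨r, hr0, fun Q _ h => absurd h ht, fun _ => h⟩
    · exact ⟨0, fun _ => le_rfl, fun Q hQ => absurd rfl hQ, fun h => absurd h hF⟩
  choose r hr0 hrw hr using hex
  let c (ε : ℝ) (Q : Pauli n) : ℝ := ∑ F, G.pathProb ε F * r F Q
  have hY : ∀ ε, G.noisy ε A ∘ₗ enc W ∘ₗ G.gInv =
      ∑ Q, (c ε Q : ℂ) • (pauliConj Q ∘ₗ enc W) := by
    intro ε
    rw [noisy_comp]
    simp only [c, Complex.ofReal_sum, Finset.sum_smul, Complex.ofReal_mul, mul_smul]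
    rw [Finset.sum_comm]
    refine Finset.sum_congr rfl fun F _ => ?_
    rw [← Finset.smul_sum]
    by_cases hF : G.IsFaultPath F
    · rw [← hr F hF]
      rfl
    · rw [G.pathProb_eq_zero hF, Complex.ofReal_zero, zero_smul, zero_smul]
  have hprob : ∀ ε, prob (G.noisy ε A ∘ₗ enc W ∘ₗ G.gInv) = ((∑ Q, c ε Q : ℝ) : ℂ) := by
    intro ε
    rw [hY, ← probLin_apply, map_sum, Complex.ofReal_sum]
    refine Finset.sum_congr rfl fun Q _ => ?_
    rw [map_smul, probLin_apply, prob_pauliConj_comp_enc hW, smul_eq_mul, mul_one]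
  have hc0 : ∀ ε, 0 ≤ ε → ε ≤ 1 → ∀ Q, 0 ≤ c ε Q := fun ε h0 h1 Q =>
    Finset.sum_nonneg fun F _ => mul_nonneg (G.pathProb_nonneg h0 h1 F) (hr0 F Q)
  -- The total coefficient is the `prob` used in the normalization. Should it vanish, `0⁻¹ = 0`
  -- makes both sides zero.
  refine ⟨fun ε Q => (∑ Q, c ε Q)⁻¹ * c ε Q, fun ε h0 h1 => ⟨fun Q => ?_, ?_⟩, fun Q hQ => ?_⟩
  · exact mul_nonneg (inv_nonneg.2 (Finset.sum_nonneg fun Q _ => hc0 ε h0 h1 Q)) (hc0 ε h0 h1 Q)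
  · rw [outputError, normalize, hprob, hY, pauliChannel, Finset.smul_sum]
    refine Finset.sum_congr rfl fun Q _ => ?_
    rw [smul_smul, Complex.ofReal_mul, Complex.ofReal_inv]
  · have h1 : IsOrd (t + 1) fun ε => (c ε Q : ℂ) := by
      simp only [c, Complex.ofReal_sum, Complex.ofReal_mul]
      refine IsOrd.sum fun F _ => ?_
      by_cases h0 : r F Q = 0
      · simpa [h0] using IsOrd.zero (M := ℂ)
      · refine ((G.pathProb_isOrd F).mul (IsOrd.const (r F Q : ℂ))).mono ?_
        have := hrw F Q h0
        omega
    have h2 : IsOrd 1 fun ε => prob (G.noisy ε A ∘ₗ enc W ∘ₗ G.gInv) - q :=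
      Gate.prob_noisy hW hq (X := fun _ => enc W) (by simpa using IsOrd.zero)
    have h3 := ((h2.inv hq0).of_sub_const.mul h1)
    rw [zero_add] at h3
    refine h3.congr (Eventually.of_forall fun ε => ?_)
    rw [hprob, Complex.ofReal_mul, Complex.ofReal_inv]

/-- Only errors of weight above `t` are ever replaced. -/
theorem correctablePart_sub (hc : ∀ P, weight P ≤ t → G.Correctable W P) {p : ℝ → Pauli n → ℝ}
    (hp : ∀ P, t < weight P → IsOrd (t + 1) fun ε => (p ε P : ℂ)) :
    IsOrd (t + 1) fun ε => correctablePart W G (p ε) - pauliChannel W (p ε) := by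
  classical
  simp only [correctablePart, pauliChannel, ← Finset.sum_sub_distrib]
  refine IsOrd.sum fun P _ => ?_
  by_cases h : G.Correctable W P
  · simpa [h] using IsOrd.zero (M := Super k n)
  · have h1 := hp P (not_le.1 fun h1 => h (hc P h1))
    exact (h1.smul_const _).sub (h1.smul_const _)

/-- Each surviving term is a correctable error or the identity. This is the P2LC counterpart of
`decodeLin_comp_inverse`, and the purpose of the replacement rule. -/
theorem Gate.Implements.decodeLin_correctablePart (hG : G.Implements W) (hW : Wᴴ * W = 1)
    (A : Finset S) (p : Pauli n → ℝ) :
    ∃ s : ℂ, decodeLin W G A (correctablePart W G p) = s • LinearMap.id := by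
  classical
  obtain ⟨q, hq⟩ := hG.exists_ideal_enc hW A
  have hex : ∀ P : Pauli n, ∃ s : ℂ, decodeLin W G A ((p P : ℂ) •
      (if G.Correctable W P then pauliConj P ∘ₗ enc W else enc W)) = s • LinearMap.id := by
    intro P
    split_ifs with h
    · obtain ⟨s, hs⟩ := h.exists_decodeLin hG hW A
      exact ⟨p P * s, by rw [map_smul, hs, smul_smul]⟩
    · exact ⟨p P * q, by rw [map_smul, decodeLin_of_ideal hW hq, smul_smul]⟩
  choose s hs using hex
  refine ⟨∑ P, s P, ?_⟩
  rw [correctablePart, map_sum, Finset.sum_smul]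
  refine Finset.sum_congr rfl fun P _ => ?_
  rw [← hs P]

end Input

/-! ### Circuits -/

section Circuit

variable {n k V t : ℕ} {S : Type*} [Fintype S] {W : Matrix (Bits n) (Bits k) ℂ}
  {G : ℕ → Gate n k S} {A : ℕ → Finset S}

theorem existsUnique_isP2LC (hW : IsStabilizerCode W) (hG : ∀ i < V, (G i).Implements W)
    (hP : ∀ i < V, (G i).HasPauliErrors W) (hFT : ∀ i < V, (G i).IsFaultTolerant W t)
    (hA : ∀ i < V, (G i).Occurs W (A i)) {j : ℕ} (hj : j + 1 < V) {ε : ℝ} (h0 : 0 ≤ ε)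
    (h1 : ε ≤ 1) : ∃! Λ', IsP2LC W G A ε j Λ' := by
  suffices h : ∃! Λ', IsP2LCInput W G A ε j Λ' by
    obtain ⟨Λ, hΛ, hu⟩ := h
    refine ⟨_, ⟨Λ, hΛ, rfl⟩, ?_⟩
    rintro _ ⟨Λ', hΛ', rfl⟩
    rw [hu Λ' hΛ']
  cases j with
  | zero => exact ⟨enc W, rfl, fun _ h => h⟩
  | succ j =>
    have hj' : j < V := by omega
    obtain ⟨p, hp, -⟩ := (hP j hj').exists_pauliChannel (hFT j hj') (hG j hj') hW.1 (hA j hj')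
    obtain ⟨hp0, hpe⟩ := hp ε h0 h1
    refine ⟨_, ⟨p ε, hp0, hpe, rfl⟩, ?_⟩
    rintro _ ⟨p', -, hp', rfl⟩
    exact correctablePart_eq hW (hp'.symm.trans hpe) _

/-- The conditioned ideal gate determines the logical gate: on code states it is `q g`, the trace
gives `q`, and `q ≠ 0` because the syndromes occur. -/
theorem logicalError_congr {G G' : Gate n k S} {A A' : Finset S} (hW : Wᴴ * W = 1)
    (hG : G.Implements W) (hG' : G'.Implements W) (hA : G.Occurs W A)
    (h : G'.ideal A' = G.ideal A) (X : Super k n) :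
    logicalError W G' A' X = logicalError W G A X := by
  obtain ⟨q, hq0, hq⟩ := hG.exists_ideal_enc_ne_zero hW hA
  obtain ⟨q', hq'⟩ := hG'.exists_ideal_enc hW A'
  rw [h, hq] at hq'
  have h1 : (q : ℂ) • G.g = (q' : ℂ) • G'.g := by
    have := congrArg (fun T => dec W ∘ₗ T) hq'
    simpa only [LinearMap.comp_smul, ← LinearMap.comp_assoc, dec_comp_enc hW,
      LinearMap.id_comp] using this
  have hone : ∀ G : Gate n k S, prob G.g = 1 := by
    intro G
    rw [prob, Gate.g, conjBy_apply, Matrix.mul_one, ← Matrix.star_eq_conjTranspose,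
      Unitary.mul_star_self_of_mem G.logical.2]
    exact prob_id
  have h2 : q = (q' : ℂ) := by
    have := congrArg prob h1
    rwa [prob_smul, prob_smul, hone, hone, mul_one, mul_one] at this
  rw [← h2] at h1
  have h3 : G.g = G'.g := by
    have := congrArg (fun T => (q : ℂ)⁻¹ • T) h1
    simpa only [smul_smul, inv_mul_cancel₀ hq0, one_smul] using this
  have h4 : G'.gInv = G.gInv := by
    calc G'.gInv = (G.gInv ∘ₗ G.g) ∘ₗ G'.gInv := by rw [gInv_comp_g, LinearMap.id_comp]
      _ = G.gInv := by rw [h3, LinearMap.comp_assoc, g_comp_gInv, LinearMap.comp_id]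
  rw [logicalError, logicalError, h4, h]

theorem isP2LC_congr (hW : Wᴴ * W = 1) {G' : ℕ → Gate n k S} {A' : ℕ → Finset S} {j : ℕ}
    (hG : (G (j + 1)).Implements W) (hA : (G (j + 1)).Occurs W (A (j + 1)))
    (hG' : (G' (j + 1)).Implements W)
    (h0 : 0 < j → G' (j - 1) = G (j - 1) ∧ A' (j - 1) = A (j - 1))
    (h1 : G' j = G j) (h2 : A' j = A j)
    (h3 : (G' (j + 1)).ideal (A' (j + 1)) = (G (j + 1)).ideal (A (j + 1)))
    (ε : ℝ) (Λ' : Super k k) : IsP2LC W G' A' ε j Λ' ↔ IsP2LC W G A ε j Λ' := by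
  have hin : ∀ Λ, IsP2LCInput W G' A' ε j Λ ↔ IsP2LCInput W G A ε j Λ := by
    intro Λ
    cases j with
    | zero => rfl
    | succ j =>
      obtain ⟨h4, h5⟩ := h0 (Nat.succ_pos j)
      simp only [Nat.add_sub_cancel] at h4 h5
      simp only [IsP2LCInput, h4, h5, h1]
  simp only [IsP2LC, hin, h1, h2, logicalError_congr hW hG hG' hA h3]

/-- The expansion is an invariant of the recursion: a gate preserves its form, and the inverse
logical channel changes it only by `O(ε ^ (t + 1))`. -/
theorem exists_expands_inChannel (hW : Wᴴ * W = 1) (hG : ∀ i < V, (G i).Implements W)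
    (hFT : ∀ i < V, (G i).IsFaultTolerant W t) (hA : ∀ i < V, (G i).Occurs W (A i)) :
    ∀ j, j < V → ∃ a, Expands W t a (fun ε => inChannel W G A ε j) ∧
      IsOrd 1 fun ε => a 0 ε - 1
  | 0, _ => ⟨_, expands_enc W t, by simpa using IsOrd.zero (M := ℂ)⟩
  | j + 1, hj => by
    obtain ⟨a, ha, ha1⟩ := exists_expands_inChannel hW hG hFT hA j (by omega)
    obtain ⟨c, hc⟩ := (hFT j (by omega)).expands_outputError (hG j (by omega)) hW (hA j (by omega))
    obtain ⟨b, hb, -, hb1⟩ := hc a _ ha ha1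
    have hΛ := (hG _ hj).logicalError_sub_id hW (fun P => (hFT _ hj).correctable hW) (hA _ hj) hb
      hb1
    exact ⟨b, (expands_comp_inverse hb hb1 hΛ).2, hb1⟩

theorem logicalChannel_sub_id (hW : Wᴴ * W = 1) (hG : ∀ i < V, (G i).Implements W)
    (hFT : ∀ i < V, (G i).IsFaultTolerant W t) (hA : ∀ i < V, (G i).Occurs W (A i)) {j : ℕ}
    (hj : j + 1 < V) :
    IsOrd (t + 1) fun ε => logicalChannel W G A ε j - LinearMap.id := by
  have hj' : j < V := by omega
  obtain ⟨a, ha, ha1⟩ := exists_expands_inChannel hW hG hFT hA j hj'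
  obtain ⟨c, hc⟩ := (hFT j hj').expands_outputError (hG j hj') hW (hA j hj')
  obtain ⟨b, hb, -, hb1⟩ := hc a _ ha ha1
  exact (hG _ hj).logicalError_sub_id hW (fun P => (hFT _ hj).correctable hW) (hA _ hj) hb hb1

theorem eventually_isUnit_logicalChannel (hW : Wᴴ * W = 1) (hG : ∀ i < V, (G i).Implements W)
    (hFT : ∀ i < V, (G i).IsFaultTolerant W t) (hA : ∀ i < V, (G i).Occurs W (A i)) {j : ℕ}
    (hj : j + 1 < V) :
    ∀ᶠ ε in 𝓝[>] (0 : ℝ),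
      IsUnit (M := Module.End ℂ (Op (Bits k))) (logicalChannel W G A ε j) :=
  (IsOrd.ringInverse (M := Op (Bits k)) (logicalChannel_sub_id hW hG hFT hA hj) (by omega)).1

theorem exists_isOrd_isP2LC_sub (hW : IsStabilizerCode W) (hG : ∀ i < V, (G i).Implements W)
    (hP : ∀ i < V, (G i).HasPauliErrors W) (hFT : ∀ i < V, (G i).IsFaultTolerant W t)
    (hA : ∀ i < V, (G i).Occurs W (A i)) {j : ℕ} (hj : j + 1 < V) :
    ∃ Λ : ℝ → Super k k, (∀ᶠ ε in 𝓝[>] (0 : ℝ), IsP2LC W G A ε j (Λ ε)) ∧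
      IsOrd (t + 2) fun ε => Λ ε - logicalChannel W G A ε j := by
  have hW1 := hW.1
  cases j with
  | zero =>
    refine ⟨fun ε => logicalChannel W G A ε 0,
      Eventually.of_forall fun ε => ⟨enc W, rfl, rfl⟩, ?_⟩
    simpa using IsOrd.zero
  | succ i =>
    have hi : i < V := by omega
    have hi1 : i + 1 < V := by omega
    obtain ⟨p, hp, hpo⟩ := (hP i hi).exists_pauliChannel (hFT i hi) (hG i hi) hW1 (hA i hi)
    obtain ⟨c, hc⟩ := (hFT i hi).expands_outputError (hG i hi) hW1 (hA i hi)
    obtain ⟨a, ha, ha1⟩ := exists_expands_inChannel hW1 hG hFT hA i hi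
    obtain ⟨b, hb, hbc, hb1⟩ := hc a _ ha ha1
    -- The same `c` serves the exact and the error-free input of the previous gate, so `b` and `b'`
    -- agree to leading order.
    obtain ⟨b', hb', hbc', hb1'⟩ := hc _ _ (expands_enc W t) (by simpa using IsOrd.zero (M := ℂ))
    have hcorr : ∀ P : Pauli n, weight P ≤ t → (G (i + 1)).Correctable W P :=
      fun P => (hFT _ hi1).correctable hW1
    have hev : ∀ᶠ ε in 𝓝[>] (0 : ℝ), 0 ≤ ε ∧ ε ≤ 1 := by
      have : Tendsto (fun ε : ℝ => ε) (𝓝[>] 0) (𝓝 0) := nhdsWithin_le_nhds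
      filter_upwards [self_mem_nhdsWithin, this.eventually (ge_mem_nhds zero_lt_one)] with ε h h'
      exact ⟨le_of_lt h, h'⟩
    let X' (ε : ℝ) : Super k n := correctablePart W (G (i + 1)) (p ε)
    have hX' : Expands W t b' X' := by
      refine hb'.of_sub ((correctablePart_sub hcorr hpo).congr ?_)
      filter_upwards [hev] with ε hε
      rw [(hp ε hε.1 hε.2).2]
    have hΛ := (hG _ hi1).logicalError_sub_id hW1 hcorr (hA _ hi1) hb hb1
    obtain ⟨hunit, hX⟩ := expands_comp_inverse hb hb1 hΛ
    choose s' hs' using fun ε =>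
      (hG _ hi1).decodeLin_correctablePart hW1 (A (i + 1)) (p ε)
    have hs : ∀ᶠ ε in 𝓝[>] (0 : ℝ), decodeLin W (G (i + 1)) (A (i + 1))
        (inChannel W G A ε (i + 1)) = prob (decodeLin W (G (i + 1)) (A (i + 1))
          (outputError (G i) ε (A i) (inChannel W G A ε i))) • LinearMap.id := by
      filter_upwards [hunit] with ε hε
      exact decodeLin_comp_inverse hε
    refine ⟨fun ε => logicalError W (G (i + 1 + 1)) (A (i + 1 + 1))
      (outputError (G (i + 1)) ε (A (i + 1)) (X' ε)), ?_, ?_⟩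
    · filter_upwards [hev] with ε hε
      obtain ⟨hp0, hpe⟩ := hp ε hε.1 hε.2
      exact ⟨X' ε, ⟨p ε, hp0, hpe, rfl⟩, rfl⟩
    · refine logicalError_outputError_sub hW1 (hFT _ hi1) (hG _ hi1) (hA _ hi1) (hG _ hj)
        (fun P => (hFT _ hj).correctable hW1) (hA _ hj) hX' hX hb1' hb1 (fun Q => ?_)
        (Eventually.of_forall hs') hs
      refine ((hbc' Q).sub (hbc Q)).congr (Eventually.of_forall fun ε => ?_)
      ring

/-- The logical infidelity is `O(ε ^ (t + 1))`, and P2LC is exact up to `O(ε ^ (t + 2))`. -/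
theorem eventually_superNorm_sub_le (hW : IsStabilizerCode W) (hG : ∀ i < V, (G i).Implements W)
    (hP : ∀ i < V, (G i).HasPauliErrors W) (hFT : ∀ i < V, (G i).IsFaultTolerant W t)
    (hA : ∀ i < V, (G i).Occurs W (A i)) {j : ℕ} (hj : j + 1 < V) :
    ∃ C > 0, ∀ᶠ ε : ℝ in 𝓝[>] 0,
      |infidelity (logicalChannel W G A ε j)| ≤ C * ε ^ (t + 1) ∧
      ∀ Λ', IsP2LC W G A ε j Λ' →
        superNorm (Λ' - logicalChannel W G A ε j) ≤ C * ε ^ (t + 2) := by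
  obtain ⟨Λ, hΛ, hord⟩ := exists_isOrd_isP2LC_sub hW hG hP hFT hA hj
  obtain ⟨C₁, hC₁, h1⟩ := (infidelity_isBigO
    (logicalChannel_sub_id hW.1 hG hFT hA hj)).exists_pos
  obtain ⟨C₂, hC₂, h2⟩ := (superNorm_isBigO hord).exists_pos
  have hlt : ∀ᶠ ε in 𝓝[>] (0 : ℝ), ε ≤ 1 := by
    have : Tendsto (fun ε : ℝ => ε) (𝓝[>] 0) (𝓝 0) := nhdsWithin_le_nhds
    exact this.eventually (ge_mem_nhds zero_lt_one)
  refine ⟨max C₁ C₂, lt_max_of_lt_left hC₁, ?_⟩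
  filter_upwards [hΛ, h1.bound, h2.bound, hlt, self_mem_nhdsWithin] with ε e0 e1 e2 e3 e4
  have e4 : 0 < ε := e4
  rw [Real.norm_eq_abs, Real.norm_eq_abs, abs_of_nonneg (pow_nonneg e4.le _)] at e1 e2
  refine ⟨e1.trans (by gcongr; exact le_max_left _ _), fun Λ' h => ?_⟩
  -- Uniqueness transfers the bound from the constructed output to an arbitrary one.
  rw [(existsUnique_isP2LC hW hG hP hFT hA hj e4.le e3).unique h e0]
  exact (le_abs_self _).trans (e2.trans (by gcongr; exact le_max_right _ _))

end Circuit

end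

end FTQC

/-! ### The main theorem -/

theorem proposition1 {n k V t : ℕ} {S : Type*} [Fintype S]
    (W : Matrix (Bits n) (Bits k) ℂ) (hW : IsStabilizerCode W)
    (G : ℕ → Gate n k S)
    (hG : ∀ i < V, (G i).Implements W)
    (hP : ∀ i < V, (G i).HasPauliErrors W)
    (hFT : ∀ i < V, (G i).IsFaultTolerant W t) :
    -- the set of all syndromes (no conditioning) is always admissible below
    (∀ i < V, (G i).Occurs W Finset.univ) ∧
    ∀ A : ℕ → Finset S, (∀ i < V, (G i).Occurs W (A i)) → ∀ j, j + 1 < V →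
      -- P2LC has exactly one output for the gate `G j`
      (∀ ε : ℝ, 0 ≤ ε → ε ≤ 1 → ∃! Λ', IsP2LC W G A ε j Λ') ∧
      -- it depends only on `G (j - 1)`, `G j` and the ideal gate `G (j + 1)` (and their syndromes)
      (∀ (G' : ℕ → Gate n k S) (A' : ℕ → Finset S), (G' (j + 1)).Implements W →
        (0 < j → G' (j - 1) = G (j - 1) ∧ A' (j - 1) = A (j - 1)) →
        G' j = G j → A' j = A j →
        (G' (j + 1)).ideal (A' (j + 1)) = (G (j + 1)).ideal (A (j + 1)) →
        ∀ (ε : ℝ) (Λ' : Super k k), IsP2LC W G' A' ε j Λ' ↔ IsP2LC W G A ε j Λ') ∧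
      -- the exact channels are well defined, the infidelity is `O(ε ^ (t + 1))`, and the
      -- approximation error is `O(ε ^ (t + 2))`
      (∃ C > 0, ∃ ε₀ > 0, ∀ ε : ℝ, 0 < ε → ε < ε₀ →
        (∀ i ≤ j, IsUnit (M := Module.End ℂ (Op (Bits k))) (logicalChannel W G A ε i)) ∧
        |infidelity (logicalChannel W G A ε j)| ≤ C * ε ^ (t + 1) ∧
        ∀ Λ', IsP2LC W G A ε j Λ' →
          superNorm (Λ' - logicalChannel W G A ε j) ≤ C * ε ^ (t + 2)) ∧
      -- hence `O(ε_L ε)`, if `ε_L` is of order `ε ^ (t + 1)` and not smaller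
      (∀ c > 0, (∀ᶠ ε : ℝ in 𝓝[>] 0, c * ε ^ (t + 1) ≤ infidelity (logicalChannel W G A ε j)) →
        ∃ C > 0, ∀ᶠ ε : ℝ in 𝓝[>] 0, ∀ Λ', IsP2LC W G A ε j Λ' →
          superNorm (Λ' - logicalChannel W G A ε j) ≤
            C * (infidelity (logicalChannel W G A ε j) * ε)) := by

  refine ⟨fun i hi => (hG i hi).occurs_univ hW.1, fun A hA j hj =>
    ⟨fun ε h0 h1 => existsUnique_isP2LC hW hG hP hFT hA hj h0 h1,
      fun G' A' hG' h0 h1 h2 h3 => isP2LC_congr hW.1 (hG _ hj) (hA _ hj) hG' h0 h1 h2 h3, ?_, ?_⟩⟩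
  · obtain ⟨C, hC, h⟩ := eventually_superNorm_sub_le hW hG hP hFT hA hj
    have hu : ∀ᶠ ε in 𝓝[>] (0 : ℝ), ∀ i ∈ Finset.range (j + 1),
        IsUnit (M := Module.End ℂ (Op (Bits k))) (logicalChannel W G A ε i) :=
      (Filter.eventually_all_finset _).2 fun i hi => by
        have := Finset.mem_range.1 hi
        exact eventually_isUnit_logicalChannel hW.1 hG hFT hA (by omega)
    -- Finitely many conditions hold eventually, so one threshold `ε₀` serves them all.
    obtain ⟨ε₀, hε₀, hsub⟩ := mem_nhdsGT_iff_exists_Ioo_subset.1 (hu.and h)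
    refine ⟨C, hC, ε₀, hε₀, fun ε h0 h1 => ?_⟩
    obtain ⟨h2, h3⟩ := hsub ⟨h0, h1⟩
    exact ⟨fun i hi => h2 i (Finset.mem_range.2 (Nat.lt_succ_of_le hi)), h3⟩
  · intro c hc hlow
    obtain ⟨C, hC, h⟩ := eventually_superNorm_sub_le hW hG hP hFT hA hj
    refine ⟨C / c, div_pos hC hc, ?_⟩
    filter_upwards [hlow, h, self_mem_nhdsWithin] with ε h1 h2 h3 Λ' hΛ'
    have h3 : 0 < ε := h3
    calc superNorm (Λ' - logicalChannel W G A ε j) ≤ C * ε ^ (t + 2) := h2.2 Λ' hΛ'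
      _ = C / c * (c * ε ^ (t + 1) * ε) := by
        field_simp
        ring
      _ ≤ _ := by gcongr
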